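/- **Setting.** Fix an integer $d\ge 2$. *Polynomial-time tests.* A (randomized) test for inputs of a given size is a program for a random-access machine over $\mathbb R$ with exact arithmetic. At unit cost each, the machine can load a real constant or an input entry, perform $+,-,\times,/$, evaluate $\exp,\log,\sqrt{\cdot}$, compare two reals and select accordingly, draw a fair coin, or draw an independent $N(0,1)$ variable; the output is in $\{0,1\}$. For each fixed input size loops are unrolled, so each instruction of the program is executed exactly once, and the running time is the number of instructions plus the number of random draws. A sequence of tests consists of one program for each index (the program and its constants may depend on the index), and it is polynomial-time if the running time on order-$d$ tensors of side length $m$ is bounded by a fixed polynomial in $m$. *CHC detection.* For $\mathbf n=(n_1,\dots,n_d)$, $\mathbf k=(k_1,\dots,k_d)$ and $\lambda\in\mathbb R$ let $$\mathscr X(\mathbf k,\mathbf n,\lambda)=\{\lambda'\,\mathbf 1_{I_1}\circ\cdots\circ\mathbf 1_{I_d}:\ I_i\subseteq[n_i],\ |I_i|=k_i,\ \lambda'\ge\lambda\}.$$ One observes $\mathcal Y=\mathcal X+\mathcal Z\in\mathbb R^{n_1\times\cdots\times n_d}$, where $\mathcal Z$ has i.i.d. $N(0,1)$ entries, and tests $H_0:\mathcal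 X=0$ against $H_1:\mathcal X\in\mathscr X(\mathbf k,\mathbf n,\lambda)$. The risk of a test $\phi$ is $$\mathcal E_{\mathrm{CHC}_D}(\phi)=\mathbb P_0(\phi(\mathcal Y)=1)+\sup_{\mathcal X\in\mathscr X(\mathbf k,\mathbf n,\lambda)}\mathbb P_{\mathcal X}(\phi(\mathcal Y)=0).$$ *HPC detection conjecture (for this $d$).* Let $\mathcal G_d(N,\frac12)$ be the random $d$-uniform hypergraph on $[N]$ that contains each $d$-element set of vertices independently with probability $\frac12$, and let $\mathcal G_d(N,\frac12,\kappa)$, $\kappa\le N$, be obtained from it by choosing a uniformly random independent $\kappa$-subset $K\subseteq[N]$ and adding all hyperedges contained in $K$. A test $\phi$ observes the adjacency tensor $\mathcal A\in\{0,1\}^{N\times\cdots\times N}$, and $\mathcal E_{\mathrm{HPC}_D}(\phi)$ is the sum of its type-I and type-II errors for $H_0:G\sim\mathcal G_d(N,\frac12)$ against $H_1:G\sim\mathcal G_d(N,\frac12,\kappa)$. The conjecture says: for every $\tau>0$ and every sequence $\kappa=\kappa_N\le N$ with $\limsup_{N\to\infty}\log\kappa_N/\log\sqrt N\le 1-\tau$,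 every sequence of polynomial-time tests $\{\phi_N\}$ satisfies $\liminf_{N\to\infty}\mathcal E_{\mathrm{HPC}_D}(\phi_N)>\frac12$. *Asymptotic regime (A2).* For eventually positive sequences write $a_t=\tilde\Theta(b_t)$ if $\lim_{t\to\infty}\frac{\log a_t}{\log t}=\lim_{t\to\infty}\frac{\log b_t}{\log t}$, both limits existing and finite. Let $0\le\alpha\le1$ and $\beta\in\mathbb R$ be fixed, and consider any sequences with $n_1=\cdots=n_d=\tilde\Theta(t)$, $k_1=\cdots=k_d=\tilde\Theta(t^{\alpha})$, $\lambda=\tilde\Theta(t^{-\beta})$ as $t\to\infty$, and $k_i\le n_i$ for all large $t$. **Theorem (Computational lower bound of $\mathrm{CHC}_D$).** Assume the HPC detection conjecture for $d$. In the regime (A2), if $$\beta>\beta^c_{\mathrm{CHC}_D}:=\left(d\alpha-\tfrac d2\right)\vee 0,$$ then every sequence of polynomial-time tests $\{\phi_t\}$ for $\mathrm{CHC}_D(\mathbf k,\mathbf n,\lambda)$ satisfies $$\liminf_{t\to\infty}\mathcal E_{\mathrm{CHC}_D}(\phi_t)\ \ge\ \tfrac12 .$$ -/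

import Mathlib

open MeasureTheory ProbabilityTheory Filter Topology
open scoped ENNReal

namespace HighOrderClustering

noncomputable section

/-! ### Randomized polynomial-time tests

The machine model is a random-access machine over the reals with exact arithmetic: at unit cost
it performs one arithmetic operation, evaluates `exp`, `log` or `sqrt`, compares two reals and
selects accordingly, reads an entry of the input, draws a fair coin or draws a standard normal
variable.  A *sequence* of tests consists of one program for each input size; it is
polynomial-time when the numbers of executed instructions and of random draws are bounded by one
polynomial in the size.  For a fixed input size all loops are unrolled, so each instruction of a
program is executed exactly once. -/

/-- Operations of a program with inputs indexed by `ι`, which may use `b` independent fair coins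
and `g` independent standard normal variables.  Arguments of type `ℕ` are register addresses. -/
inductive Op (ι : Type) (b g : ℕ) : Type
  | const (c : ℝ)
  | input (i : ι)
  | coin (j : Fin b)
  | normal (j : Fin g)
  | add (p q : ℕ)
  | sub (p q : ℕ)
  | mul (p q : ℕ)
  | div (p q : ℕ)
  | exp (p : ℕ)
  | log (p : ℕ)
  | sqrt (p : ℕ)
  /-- The content of register `r` if (content of `p`) `≤` (content of `q`), else that of `s`. -/
  | select (p q r s : ℕ)

/-- The value computed by one operation, given the input `x`, the coins `c`, the normal variables
`z` and the current contents `m` of the registers. -/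
def Op.value {ι : Type} {b g : ℕ} (x : ι → ℝ) (c : Fin b → Bool) (z : Fin g → ℝ)
    (m : ℕ → ℝ) : Op ι b g → ℝ
  | .const a => a
  | .input i => x i
  | .coin j => if c j then 1 else 0
  | .normal j => z j
  | .add p q => m p + m q
  | .sub p q => m p - m q
  | .mul p q => m p * m q
  | .div p q => m p / m q
  | .exp p => Real.exp (m p)
  | .log p => Real.log (m p)
  | .sqrt p => Real.sqrt (m p)
  | .select p q r s => if m p ≤ m q then m r else m s

/-- A randomized program: each instruction `(r, o)` of `code` stores in register `r` the value
of the operation `o`. -/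
structure Program (ι : Type) : Type where
  /-- the number of fair coins that are drawn -/
  coins : ℕ
  /-- the number of standard normal variables that are drawn -/
  normals : ℕ
  /-- the instructions, executed in order -/
  code : List (ℕ × Op ι coins normals)

namespace Program

variable {ι : Type} (P : Program ι)

/-- The running time: one unit for each random draw and each executed instruction. -/
def time : ℕ := P.coins + P.normals + P.code.length

/-- The contents of the registers after the run; all registers hold `0` initially. -/
def run (x : ι → ℝ) (c : Fin P.coins → Bool) (z : Fin P.normals → ℝ) : ℕ → ℝ :=
  P.code.foldl (fun m a => Function.update m a.1 (a.2.value x c z m)) (fun _ => 0)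

/-- The decision: `true` (reject the null hypothesis, "1") if register `0` ends up positive,
`false` (accept the null hypothesis, "0") otherwise. -/
def output (x : ι → ℝ) (c : Fin P.coins → Bool) (z : Fin P.normals → ℝ) : Bool :=
  decide (0 < P.run x c z 0)

/-- The joint law of the independent fair coins and standard normal variables of the program. -/
def randomness : Measure ((Fin P.coins → Bool) × (Fin P.normals → ℝ)) :=
  (Measure.pi fun _ => (PMF.uniformOfFintype Bool).toMeasure).prod
    (Measure.pi fun _ => gaussianReal 0 1)

/-- The probability that the test outputs `o` when its input is drawn from the law `μ`,
independently of the randomness of the test. -/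
def outputProb (μ : Measure (ι → ℝ)) (o : Bool) : ℝ≥0∞ :=
  (μ.prod P.randomness) {q | P.output q.1 q.2.1 q.2.2 = o}

end Program

/-- A sequence of randomized tests, the `t`-th of which takes inputs of size parameter `size t`,
is polynomial-time if its running time is bounded by a polynomial in the size parameter. -/
def IsPolyTime {ι : ℕ → Type} (size : ℕ → ℕ) (φ : ∀ t, Program (ι t)) : Prop :=
  ∃ p : Polynomial ℕ, ∀ t, (φ t).time ≤ p.eval (size t)

/-! ### Constant high-order clustering: detection -/

/-- Order-`d` real tensors of dimensions `n 0 × ⋯ × n (d - 1)`. -/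
abbrev Tensor {d : ℕ} (n : Fin d → ℕ) : Type := (∀ i, Fin (n i)) → ℝ

/-- The signal tensors `lam' • 1_{I 0} ∘ ⋯ ∘ 1_{I (d - 1)}` with `I i ⊆ [n i]`, `|I i| = k i` and
`lam' ≥ lam`. -/
def chcSignals {d : ℕ} (n k : Fin d → ℕ) (lam : ℝ) : Set (Tensor n) :=
  {X | ∃ lam' : ℝ, lam ≤ lam' ∧ ∃ I : ∀ i, Finset (Fin (n i)), (∀ i, (I i).card = k i) ∧
    X = fun j => lam' * ∏ i, (if j i ∈ I i then 1 else 0)}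

/-- The law of the observation `Y = X + Z`, where `Z` has independent standard normal entries. -/
def observationLaw {d : ℕ} {n : Fin d → ℕ} (X : Tensor n) : Measure (Tensor n) :=
  (Measure.pi fun _ => gaussianReal 0 1).map fun Z => X + Z

/-- Type-I error plus worst-case type-II error of a test of `X = 0` against
`X ∈ chcSignals n k lam`. -/
def chcRisk {d : ℕ} (n k : Fin d → ℕ) (lam : ℝ) (φ : Program (∀ i, Fin (n i))) : ℝ≥0∞ :=
  φ.outputProb (observationLaw 0) true +
    ⨆ X ∈ chcSignals n k lam, φ.outputProb (observationLaw X) false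

/-! ### Hypergraphic planted clique detection -/

/-- A `d`-uniform hypergraph on the vertex set `Fin N`, given by the indicator function of its
set of hyperedges among all sets of `d` vertices. -/
abbrev Hypergraph (d N : ℕ) : Type := {e : Finset (Fin N) // e.card = d} → Bool

/-- The adjacency tensor: the entry at `(i_1, …, i_d)` is `1` if `i_1, …, i_d` are distinct and
`{i_1, …, i_d}` is a hyperedge, and `0` otherwise. -/
def adjacency {d N : ℕ} (G : Hypergraph d N) : (Fin d → Fin N) → ℝ := fun i =>
  if h : (Finset.univ.image i).card = d then (if G ⟨Finset.univ.image i, h⟩ then 1 else 0) else 0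

/-- The Erdős–Rényi law: each hyperedge is present independently with probability `1/2`. -/
def erdosRenyi (d N : ℕ) : Measure (Hypergraph d N) :=
  Measure.pi fun _ => (PMF.uniformOfFintype Bool).toMeasure

/-- Add to `G` all hyperedges whose vertices all belong to `K`. -/
def plant {d N : ℕ} (K : Finset (Fin N)) (G : Hypergraph d N) : Hypergraph d N :=
  fun e => decide (e.1 ⊆ K) || G e

/-- The planted clique law: plant a clique on a uniformly random set of `κ` vertices in an
independent Erdős–Rényi hypergraph (for `κ ≤ N`). -/
def plantedClique (d N κ : ℕ) : Measure (Hypergraph d N) :=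
  ∑ K ∈ Finset.powersetCard κ (Finset.univ : Finset (Fin N)),
    (N.choose κ : ℝ≥0∞)⁻¹ • (erdosRenyi d N).map (plant K)

/-- Type-I error plus type-II error of a test that observes the adjacency tensor, for the
Erdős–Rényi law against the planted clique law. -/
def hpcRisk (d N κ : ℕ) (φ : Program (Fin d → Fin N)) : ℝ≥0∞ :=
  φ.outputProb ((erdosRenyi d N).map adjacency) true +
    φ.outputProb ((plantedClique d N κ).map adjacency) false

/-- The hypergraphic planted clique detection conjecture for order `d`: if
`limsup log κ_N / log √N ≤ 1 - τ` for some `τ > 0`, then every sequence of polynomial-time tests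
has asymptotic risk larger than `1/2`. -/
def HPCDetectionConjecture (d : ℕ) : Prop :=
  ∀ τ : ℝ, 0 < τ → ∀ κ : ℕ → ℕ, (∀ N, κ N ≤ N) →
    limsup (fun N : ℕ => ((Real.log (κ N) / Real.log (Real.sqrt N) : ℝ) : EReal)) atTop
      ≤ ((1 - τ : ℝ) : EReal) →
    ∀ φ : ∀ N : ℕ, Program (Fin d → Fin N), IsPolyTime (fun N => N) φ →
      1 / 2 < liminf (fun N => hpcRisk d N (κ N) (φ N)) atTop

/-! ### Asymptotic regime -/

/-- `a = Θ̃(b)`: the two (eventually positive) sequences have the same polynomial order,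
`lim log a_n / log n = lim log b_n / log n`. -/
def SoftTheta (a b : ℕ → ℝ) : Prop :=
  (∀ᶠ n in atTop, 0 < a n) ∧ (∀ᶠ n in atTop, 0 < b n) ∧
    ∃ L : ℝ, Tendsto (fun n : ℕ => Real.log (a n) / Real.log n) atTop (𝓝 L) ∧
      Tendsto (fun n : ℕ => Real.log (b n) / Real.log n) atTop (𝓝 L)

end

end HighOrderClustering

open HighOrderClustering

/-! The proof is a reduction. If the risk of a clustering test is below `1/2` for infinitely many
`t`, then planted cliques can be detected at infinitely many sizes `N`, with clique size below the
square-root threshold and risk at most `1/2`.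

Blow-up. Each of `N = n / ℓ` vertices becomes a block of `ℓ` rows, with `ℓ` of order `t ^ x`, and a
tensor entry is governed by the hyperedge of the vertices of its rows. A clique set of size `d * k'`
is split into `d` disjoint groups, one per mode; an interval of rows in each mode keeps exactly `k`
rows over its group (`exists_cuts`). The planted entries then form an exact `k × ⋯ × k` block, free
of repeated vertices. The intervals depend on the unknown clique, so all `(n + 1) ^ (2 * d)` choices
are tried (`exists_test_of_family`).

Gaussianization. The value one of a bit selects a Gaussian vector with mean `m`; the value zero
selects a vector of law `Q₀`, chosen so that the average of the two laws is nearly standard Gaussian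
(`exists_gaussian_complement`). This works when the squared norm of `m` is at most a small `σ`, with
error exponentially small in `1 / σ`. A bit that planting forces to one yields the shift exactly
(`exists_seedLaw`).

Amplification. Trying many intervals needs small errors, whereas risk below `1/2` only gives
rejection probabilities `p` and at least `p + 1/2`. Hence every bit drives `R` copies of the tensor
at once, and the test votes over them (`exists_vote`). All randomness is finally fixed at a value no
worse than average; programs may contain arbitrary real constants.

Exponents. Up to small losses, the clique has size `t ^ max (α - x) 0` among `t ^ (1 - x)` vertices,
and one bit carries a squared shift of order `t ^ (d * x - 2 * β)`. So `x` must satisfy `max (2 * α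
- 1) 0 < x < min 1 (2 * β / d)`. For `α < 1` such an `x` exists exactly because `β > max (d * α - d
/ 2) 0`. For `α = 1` there is none, but then `β > d / 2`, the whole signal has vanishing norm and no
test succeeds (`le_chcRisk_of_weak`). -/

namespace HighOrderClustering

/-! ### Composition of programs -/

/-- The contents of the registers after executing `code` from the contents `m`. -/
noncomputable def execute {ι : Type} {b g : ℕ} (x : ι → ℝ) (c : Fin b → Bool) (z : Fin g → ℝ)
    (code : List (ℕ × Op ι b g)) (m : ℕ → ℝ) : ℕ → ℝ :=
  code.foldl (fun m a => Function.update m a.1 (a.2.value x c z m)) m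

section execute

variable {ι : Type} {b g : ℕ} (x : ι → ℝ) (c : Fin b → Bool) (z : Fin g → ℝ)

@[simp] lemma execute_nil (m : ℕ → ℝ) : execute x c z [] m = m := rfl

@[simp] lemma execute_cons (a : ℕ × Op ι b g) (code : List (ℕ × Op ι b g)) (m : ℕ → ℝ) :
    execute x c z (a :: code) m =
      execute x c z code (Function.update m a.1 (a.2.value x c z m)) := rfl

lemma execute_append (C D : List (ℕ × Op ι b g)) (m : ℕ → ℝ) :
    execute x c z (C ++ D) m = execute x c z D (execute x c z C m) :=
  List.foldl_append

lemma execute_of_forall_ne (code : List (ℕ × Op ι b g)) (m : ℕ → ℝ) (r : ℕ)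
    (hr : ∀ a ∈ code, a.1 ≠ r) : execute x c z code m r = m r := by
  induction code generalizing m with
  | nil => rfl
  | cons a C ih =>
    rw [execute_cons, ih _ fun a' h => hr a' (List.mem_cons_of_mem _ h),
      Function.update_of_ne (hr a List.mem_cons_self).symm]

lemma execute_const_zero (l : List ℕ) (m : ℕ → ℝ) (r : ℕ) :
    execute x c z (l.map fun q => (q, Op.const 0)) m r = if r ∈ l then 0 else m r := by
  induction l generalizing m with
  | nil => simp
  | cons q l ih =>
    rw [List.map_cons, execute_cons, ih]
    by_cases h : r ∈ l
    · simp [h]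
    · by_cases hq : r = q
      · subst hq; simp [Op.value]
      · simp [h, hq]

end execute

/-- `F` is evaluated within time `T` by a deterministic piece of code which, for any `s` such that
all registers from `s` on hold `0`, stores the value in register `s` and leaves no other trace. -/
def Evaluable {ι : Type} (F : (ι → ℝ) → ℝ) (T : ℕ) : Prop :=
  ∀ s : ℕ, ∃ C : List (ℕ × Op ι 0 0), C.length ≤ T ∧ ∀ (x : ι → ℝ) (c : Fin 0 → Bool)
    (z : Fin 0 → ℝ) (m : ℕ → ℝ), (∀ r, s ≤ r → m r = 0) →
      execute x c z C m = Function.update m s (F x)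

namespace Evaluable

variable {ι : Type} {F G : (ι → ℝ) → ℝ} {T U : ℕ}

lemma mono (hF : Evaluable F T) (h : T ≤ U) : Evaluable F U := fun s => by
  obtain ⟨C, hC, h'⟩ := hF s
  exact ⟨C, hC.trans h, h'⟩

lemma zero : Evaluable (fun _ : ι → ℝ => 0) 0 := fun s =>
  ⟨[], le_rfl, fun x c z m hm => by simp [← hm s le_rfl]⟩

lemma add (hF : Evaluable F T) (hG : Evaluable G U) :
    Evaluable (fun x => F x + G x) (T + U + 2) := fun s => by
  obtain ⟨C, hC, hC'⟩ := hF s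
  obtain ⟨D, hD, hD'⟩ := hG (s + 1)
  -- The second value is computed one register higher, beside the first; the last instruction
  -- restores the zero there.
  refine ⟨C ++ (D ++ [(s, .add s (s + 1)), (s + 1, .const 0)]), ?_, fun x c z m hm => ?_⟩
  · simp only [List.length_append, List.length_cons, List.length_nil]; omega
  · rw [execute_append, execute_append, hC' x c z m hm, hD' x c z]
    · have h1 := hm (s + 1) (by omega)
      ext r
      by_cases hr : r = s
      · subst hr; simp [Op.value]
      · by_cases hr' : r = s + 1
        · subst hr'; simp [Op.value, h1]
        · simp [Op.value, hr, hr']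
    · intro r hr
      rw [Function.update_of_ne (by omega), hm r (by omega)]

lemma sum {κ : Type} (S : Finset κ) {F : κ → (ι → ℝ) → ℝ} (hF : ∀ i ∈ S, Evaluable (F i) T) :
    Evaluable (fun x => ∑ i ∈ S, F i x) (S.card * (T + 2)) := by
  classical
  induction S using Finset.induction_on with
  | empty => simpa using zero
  | insert i S hi ih =>
    simp only [Finset.sum_insert hi, Finset.card_insert_of_notMem hi]
    refine ((hF i (Finset.mem_insert_self i S)).add
      (ih fun j hj => hF j (Finset.mem_insert_of_mem hj))).mono (le_of_eq ?_)
    ring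

lemma ite_le (hF : Evaluable F T) (θ : ℝ) :
    Evaluable (fun x => if θ ≤ F x then 1 else 0) (T + 5) := fun s => by
  obtain ⟨C, hC, hC'⟩ := hF s
  -- Register `s + 3` is never written and supplies the value `0`.
  refine ⟨C ++ [(s + 1, .const θ), (s + 2, .const 1), (s, .select (s + 1) s (s + 2) (s + 3)),
    (s + 1, .const 0), (s + 2, .const 0)], ?_, fun x c z m hm => ?_⟩
  · simp only [List.length_append, List.length_cons, List.length_nil]; omega
  · rw [execute_append, hC' x c z m hm]
    have h1 := hm (s + 1) (by omega)
    have h2 := hm (s + 2) (by omega)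
    have h3 := hm (s + 3) (by omega)
    ext r
    by_cases hr : r = s
    · subst hr; simp [Op.value, h3]
    · by_cases hr' : r = s + 1
      · subst hr'; simp [Op.value, h1]
      · by_cases hr'' : r = s + 2
        · subst hr''; simp [Op.value, h2]
        · simp [Op.value, hr, hr', hr'']

lemma ite_pos (hF : Evaluable F T) :
    Evaluable (fun x => if 0 < F x then 1 else 0) (T + 3) := fun s => by
  obtain ⟨C, hC, hC'⟩ := hF s
  -- `select` only tests `≤`, so strict positivity is its second branch; the untouched register `s +
  -- 2` serves both as threshold and as value `0`.
  refine ⟨C ++ [(s + 1, .const 1), (s, .select s (s + 2) (s + 2) (s + 1)),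
    (s + 1, .const 0)], ?_, fun x c z m hm => ?_⟩
  · simp only [List.length_append, List.length_cons, List.length_nil]; omega
  · rw [execute_append, hC' x c z m hm]
    have h1 := hm (s + 1) (by omega)
    have h2 := hm (s + 2) (by omega)
    ext r
    by_cases hr : r = s
    · subst hr
      rcases le_or_gt (F x) 0 with h | h
      · simp [Op.value, h2, h, not_lt.2 h]
      · simp [Op.value, h2, h, not_le.2 h]
    · by_cases hr' : r = s + 1
      · subst hr'; simp [Op.value, h1]
      · simp [Op.value, hr, hr']

/-- The deterministic program that decides whether `F` is positive. -/
lemma exists_program (hF : Evaluable F T) : ∃ P : Program ι, P.time ≤ T ∧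
    ∀ x c z, P.output x c z = decide (0 < F x) := by
  obtain ⟨C, hC, hC'⟩ := hF 0
  refine ⟨⟨0, 0, C⟩, by simpa [Program.time] using hC, fun x c z => ?_⟩
  have := hC' x c z (fun _ => 0) fun _ _ => rfl
  have h : Program.run ⟨0, 0, C⟩ x c z = Function.update (fun _ => 0) 0 (F x) := this
  simp [Program.output, h]

end Evaluable

/-! ### Fixing the randomness and substituting affine functions for the inputs -/

/-- Register contents that agree with `m₀` below `s`, hold `0` at `s` and continue with `m`. -/
noncomputable def shiftRegisters (s : ℕ) (m₀ m : ℕ → ℝ) : ℕ → ℝ := fun r =>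
  if r < s then m₀ r else if r = s then 0 else m (r - (s + 1))

lemma shiftRegisters_apply_add (s : ℕ) (m₀ m : ℕ → ℝ) (r : ℕ) :
    shiftRegisters s m₀ m (s + 1 + r) = m r := by
  have h1 : ¬ (s + 1 + r < s) := by omega
  have h2 : ¬ (s + 1 + r = s) := by omega
  simp [shiftRegisters, h1, h2]

lemma shiftRegisters_apply_self (s : ℕ) (m₀ m : ℕ → ℝ) : shiftRegisters s m₀ m s = 0 := by
  simp [shiftRegisters]

lemma update_shiftRegisters (s : ℕ) (m₀ m : ℕ → ℝ) (r : ℕ) (a : ℝ) :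
    Function.update (shiftRegisters s m₀ m) (s + 1 + r) a =
      shiftRegisters s m₀ (Function.update m r a) := by
  ext q
  by_cases hq : q = s + 1 + r
  · subst hq; rw [shiftRegisters_apply_add]; simp
  · rw [Function.update_of_ne hq]
    unfold shiftRegisters
    split_ifs with h1 h2
    · rfl
    · rfl
    · rw [Function.update_of_ne (by omega)]

/-- Code on the inputs `ι` that simulates the instruction `(r, o)` with its registers shifted by
`s + 1`, its random variables fixed to `c` and `z`, and input `i` replaced by
`a i + x (v i) * w i`. -/
noncomputable def substInstr {ι κ : Type} {b g : ℕ} (c : Fin b → Bool) (z : Fin g → ℝ)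
    (a w : κ → ℝ) (v : κ → ι) (s : ℕ) (r : ℕ) : Op κ b g → List (ℕ × Op ι 0 0)
  | .const e => [(s + 1 + r, .const e)]
  | .input i => [(s, .const (w i)), (s + 1 + r, .input (v i)), (s + 1 + r, .mul (s + 1 + r) s),
      (s, .const (a i)), (s + 1 + r, .add s (s + 1 + r)), (s, .const 0)]
  | .coin j => [(s + 1 + r, .const (if c j then 1 else 0))]
  | .normal j => [(s + 1 + r, .const (z j))]
  | .add p q => [(s + 1 + r, .add (s + 1 + p) (s + 1 + q))]
  | .sub p q => [(s + 1 + r, .sub (s + 1 + p) (s + 1 + q))]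
  | .mul p q => [(s + 1 + r, .mul (s + 1 + p) (s + 1 + q))]
  | .div p q => [(s + 1 + r, .div (s + 1 + p) (s + 1 + q))]
  | .exp p => [(s + 1 + r, .exp (s + 1 + p))]
  | .log p => [(s + 1 + r, .log (s + 1 + p))]
  | .sqrt p => [(s + 1 + r, .sqrt (s + 1 + p))]
  | .select p q p' q' =>
      [(s + 1 + r, .select (s + 1 + p) (s + 1 + q) (s + 1 + p') (s + 1 + q'))]

section subst

variable {ι κ : Type} {b g : ℕ} (c : Fin b → Bool) (z : Fin g → ℝ)
    (a w : κ → ℝ) (v : κ → ι) (s : ℕ)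

lemma length_substInstr_le (r : ℕ) (o : Op κ b g) :
    (substInstr c z a w v s r o).length ≤ 6 := by
  cases o <;> simp [substInstr]

lemma execute_substInstr (r : ℕ) (o : Op κ b g) (x : ι → ℝ) (c' : Fin 0 → Bool)
    (z' : Fin 0 → ℝ) (m₀ m : ℕ → ℝ) :
    execute x c' z' (substInstr c z a w v s r o) (shiftRegisters s m₀ m) =
      shiftRegisters s m₀ (Function.update m r
        (o.value (fun i => a i + x (v i) * w i) c z m)) := by
  rw [← update_shiftRegisters]
  cases o with
  | input i =>
    have h0 := shiftRegisters_apply_self s m₀ m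
    have hne : s + 1 + r ≠ s := by omega
    ext q
    by_cases hq : q = s
    · subst hq; simp [substInstr, Op.value, h0, hne.symm]
    · by_cases hq' : q = s + 1 + r
      · subst hq'; simp [substInstr, Op.value, hne, hne.symm]
      · simp [substInstr, Op.value, hq, hq']
  | _ => simp [substInstr, Op.value, shiftRegisters_apply_add]

lemma execute_flatMap_substInstr (code : List (ℕ × Op κ b g)) (x : ι → ℝ) (c' : Fin 0 → Bool)
    (z' : Fin 0 → ℝ) (m₀ m : ℕ → ℝ) :
    execute x c' z' (code.flatMap fun i => substInstr c z a w v s i.1 i.2)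
        (shiftRegisters s m₀ m) =
      shiftRegisters s m₀ (execute (fun i => a i + x (v i) * w i) c z code m) := by
  induction code generalizing m with
  | nil => rfl
  | cons i C ih => rw [List.flatMap_cons, execute_append, execute_substInstr, ih, execute_cons]

end subst

/-- A choice between two fixed reals according to a bit is affine in the bit, so this form of input
covers every tensor fed to the test. Each instruction costs at most six for its simulation and one
for clearing its register; one more moves the result. -/
lemma Program.evaluable_run_subst {ι κ : Type} (P : Program κ) (c : Fin P.coins → Bool)
    (z : Fin P.normals → ℝ) (a w : κ → ℝ) (v : κ → ι) :
    Evaluable (fun x : ι → ℝ => P.run (fun i => a i + x (v i) * w i) c z 0)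
      (7 * P.time + 1) := fun s => by
  refine ⟨(P.code.flatMap fun i => substInstr c z a w v s i.1 i.2) ++
    -- Register `s` holds `0` after the simulation, so this addition copies the simulated register
    -- `0`. Every register the simulation may have written is then cleared.
    ([(s, .add s (s + 1))] ++ (P.code.map fun i => s + 1 + i.1).map fun q => (q, Op.const 0)),
    ?_, fun x c' z' m hm => ?_⟩
  · have h : ∀ l : List (ℕ × Op κ P.coins P.normals),
        (l.flatMap fun i => substInstr c z a w v s i.1 i.2).length ≤ 6 * l.length := by
      intro l
      induction l with
      | nil => simp
      | cons i l ih =>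
        have := length_substInstr_le c z a w v s i.1 i.2
        simp only [List.flatMap_cons, List.length_append, List.length_cons]
        omega
    have := h P.code
    simp only [List.length_append, List.length_cons, List.length_nil, List.length_map,
      Program.time]
    omega
  · have h0 : m = shiftRegisters s m (fun _ => 0) := by
      ext r
      unfold shiftRegisters
      split_ifs with h1 h2
      · rfl
      · exact hm r h2.ge
      · exact hm r (not_lt.1 h1)
    rw [execute_append, execute_append]
    nth_rewrite 1 [h0]
    rw [execute_flatMap_substInstr]
    have hrun : execute (fun i => a i + x (v i) * w i) c z P.code (fun _ => 0) =
      P.run (fun i => a i + x (v i) * w i) c z := rfl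
    rw [hrun]
    set M := P.run (fun i => a i + x (v i) * w i) c z with hM
    ext r
    rw [execute_const_zero]
    simp only [execute_cons, execute_nil, Op.value]
    have h1 : shiftRegisters s m M (s + 1) = M 0 := shiftRegisters_apply_add s m M 0
    rw [h1, shiftRegisters_apply_self]
    by_cases hr : r = s
    · subst hr
      rw [if_neg]
      · simp [hM]
      · simp only [List.mem_map, not_exists, not_and]; intro i _ h; omega
    · rw [Function.update_of_ne hr, Function.update_of_ne hr]
      rcases lt_or_gt_of_ne hr with h | h
      · rw [if_neg]
        · simp [shiftRegisters, h]
        · simp only [List.mem_map, not_exists, not_and]; intro i _ h; omega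
      · obtain ⟨q, rfl⟩ : ∃ q, r = s + 1 + q := ⟨r - (s + 1), by omega⟩
        rw [hm _ (by omega), shiftRegisters_apply_add]
        split_ifs with h'
        · rfl
        · rw [hM]
          refine (execute_of_forall_ne _ _ _ P.code (fun _ => 0) q fun i hi hq => h' ?_)
          exact List.mem_map.2 ⟨i, hi, by rw [hq]⟩

lemma Program.evaluable_output_subst {ι κ : Type} (P : Program κ) (c : Fin P.coins → Bool)
    (z : Fin P.normals → ℝ) (a w : κ → ℝ) (v : κ → ι) :
    Evaluable (fun x : ι → ℝ => if P.output (fun i => a i + x (v i) * w i) c z then 1 else 0)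
      (7 * P.time + 4) := by
  simpa [Program.output] using (P.evaluable_run_subst c z a w v).ite_pos

/-! ### Measurability of the output -/

lemma measurable_execute {ι : Type} {b g : ℕ} (code : List (ℕ × Op ι b g)) {Ω : Type*}
    [MeasurableSpace Ω] {X : Ω → ι → ℝ} {c : Ω → Fin b → Bool} {z : Ω → Fin g → ℝ}
    (hX : Measurable X) (hc : Measurable c) (hz : Measurable z) {m : Ω → ℕ → ℝ}
    (hm : Measurable m) : Measurable fun ω => execute (X ω) (c ω) (z ω) code (m ω) := by
  induction code generalizing m with
  | nil => exact hm
  | cons a C ih =>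
    simp only [execute_cons]
    refine ih ?_
    have hm' : ∀ r, Measurable fun ω => m ω r := fun r => (measurable_pi_apply r).comp hm
    have hv : Measurable fun ω => a.2.value (X ω) (c ω) (z ω) (m ω) := by
      rcases a with ⟨r, o⟩
      cases o with
      | const => exact measurable_const
      | input i => exact (measurable_pi_apply i).comp hX
      | coin j =>
        exact Measurable.ite (((measurable_pi_apply j).comp hc) (measurableSet_singleton true))
          measurable_const measurable_const
      | normal j => exact (measurable_pi_apply j).comp hz
      | add p q => exact (hm' p).add (hm' q)
      | sub p q => exact (hm' p).sub (hm' q)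
      | mul p q => exact (hm' p).mul (hm' q)
      | div p q => exact (hm' p).div (hm' q)
      | exp p => exact (hm' p).exp
      | log p => exact (hm' p).log
      | sqrt p => exact (hm' p).sqrt
      | select p q r s => exact Measurable.ite (measurableSet_le (hm' p) (hm' q)) (hm' r) (hm' s)
    refine measurable_pi_iff.2 fun r => ?_
    by_cases h : r = a.1
    · subst h; simpa using hv
    · simpa [h] using hm' r

lemma Program.measurable_output {ι : Type} (P : Program ι) {Ω : Type*}
    [MeasurableSpace Ω] {X : Ω → ι → ℝ} {c : Ω → Fin P.coins → Bool}
    {z : Ω → Fin P.normals → ℝ} (hX : Measurable X) (hc : Measurable c) (hz : Measurable z) :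
    Measurable fun ω => P.output (X ω) (c ω) (z ω) := by
  have h := (measurable_pi_apply 0).comp
    (measurable_execute P.code hX hc hz (m := fun _ _ => 0) measurable_const)
  refine measurable_to_bool ?_
  have : (fun ω => P.output (X ω) (c ω) (z ω)) ⁻¹' {true} =
      {ω | 0 < execute (X ω) (c ω) (z ω) P.code (fun _ => 0) 0} := by
    ext ω
    simp only [Set.mem_preimage, Set.mem_singleton_iff, Program.output, decide_eq_true_eq]
    rfl
  rw [this]
  exact measurableSet_lt measurable_const h

/-! ### Finite product measures -/

section pi

variable {ι : Type*} [Fintype ι] {X : ι → Type*} [∀ i, MeasurableSpace (X i)]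

lemma lintegral_pi_prod (μ : ∀ i, Measure (X i)) [∀ i, IsProbabilityMeasure (μ i)]
    {f : ∀ i, X i → ℝ≥0∞} (hf : ∀ i, Measurable (f i)) :
    ∫⁻ x, ∏ i, f i (x i) ∂Measure.pi μ = ∏ i, ∫⁻ x, f i x ∂μ i := by
  classical
  have hF : Measurable fun x : ∀ i, X i => ∏ i, f i (x i) :=
    Finset.measurable_prod _ fun i _ => (hf i).comp (measurable_pi_apply i)
  have key : ∀ s : Finset ι, (∫⋯∫⁻_s, (fun x => ∏ i, f i (x i)) ∂μ) =
      fun x => (∏ i ∈ s, ∫⁻ y, f i y ∂μ i) * ∏ i ∈ sᶜ, f i (x i) := by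
    intro s
    induction s using Finset.induction_on with
    | empty => simp
    | insert i s hi ih =>
      ext x
      rw [lmarginal_insert _ hF hi, ih]
      have hmem : i ∈ sᶜ := by simpa using hi
      have h : ∀ y, (∏ j ∈ sᶜ, f j (Function.update x i y j)) =
          f i y * ∏ j ∈ (insert i s)ᶜ, f j (x j) := by
        intro y
        rw [← Finset.mul_prod_erase _ _ hmem, Function.update_self, Finset.compl_insert]
        congr 1
        refine Finset.prod_congr rfl fun j hj => ?_
        rw [Function.update_of_ne (Finset.ne_of_mem_erase hj)]
      simp_rw [h]
      rw [lintegral_const_mul _ ((hf i).mul_const _), lintegral_mul_const _ (hf i),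
        Finset.prod_insert hi]
      ring
  rcases isEmpty_or_nonempty (∀ i, X i) with h | ⟨⟨x⟩⟩
  · obtain ⟨i, hi⟩ := isEmpty_pi.1 h
    have := (μ i).eq_zero_of_isEmpty
    exact absurd this (IsProbabilityMeasure.ne_zero (μ i))
  · rw [lintegral_eq_lmarginal_univ x, key]
    simp

lemma pi_withDensity (μ : ∀ i, Measure (X i)) [∀ i, IsProbabilityMeasure (μ i)]
    {f : ∀ i, X i → ℝ≥0∞} (hf : ∀ i, Measurable (f i))
    [∀ i, IsProbabilityMeasure ((μ i).withDensity (f i))] :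
    Measure.pi (fun i => (μ i).withDensity (f i)) =
      (Measure.pi μ).withDensity fun x => ∏ i, f i (x i) := by
  classical
  refine Measure.pi_eq fun s hs => ?_
  rw [withDensity_apply _ (MeasurableSet.univ_pi hs), ← lintegral_indicator (.univ_pi hs)]
  have h : (Set.univ.pi s).indicator (fun x : ∀ i, X i => ∏ i, f i (x i)) =
      fun x => ∏ i, (s i).indicator (f i) (x i) := by
    ext x
    by_cases hx : x ∈ Set.univ.pi s
    · rw [Set.indicator_of_mem hx]
      exact Finset.prod_congr rfl fun i _ => (Set.indicator_of_mem (hx i trivial) _).symm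
    · rw [Set.indicator_of_notMem hx]
      simp only [Set.mem_pi, Set.mem_univ, true_implies, not_forall] at hx
      obtain ⟨i, hi⟩ := hx
      exact (Finset.prod_eq_zero (Finset.mem_univ i) (Set.indicator_of_notMem hi _)).symm
  rw [h, lintegral_pi_prod μ fun i => (hf i).indicator (hs i)]
  exact Finset.prod_congr rfl fun i _ => by
    rw [lintegral_indicator (hs i), withDensity_apply _ (hs i)]

/-- Hybrid argument: the factors are exchanged one at a time, and since `f ≤ 1` each exchange costs
at most `δ`. One-sided domination suffices, because only upper bounds on error probabilities are
needed. -/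
lemma lintegral_pi_le_add (μ γ ν : ∀ i, Measure (X i)) [∀ i, IsProbabilityMeasure (μ i)]
    [∀ i, IsProbabilityMeasure (γ i)] {δ : ℝ≥0∞} (h : ∀ i, μ i ≤ γ i + ν i)
    (hν : ∀ i, ν i Set.univ ≤ δ) {f : (∀ i, X i) → ℝ≥0∞} (hf : Measurable f)
    (hf1 : ∀ x, f x ≤ 1) :
    ∫⁻ x, f x ∂Measure.pi μ ≤ ∫⁻ x, f x ∂Measure.pi γ + Fintype.card ι * δ := by
  classical
  have hle : ∀ (s : Finset ι) x, (∫⋯∫⁻_s, f ∂γ) x ≤ 1 := by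
    intro s x
    refine (lmarginal_mono (μ := γ) (s := s) (g := fun _ => 1) hf1 x).trans ?_
    simp [lmarginal]
  have key : ∀ s : Finset ι, ∀ x, (∫⋯∫⁻_s, f ∂μ) x ≤ (∫⋯∫⁻_s, f ∂γ) x + s.card * δ := by
    intro s
    induction s using Finset.induction_on with
    | empty => simp
    | insert i s hi ih =>
      intro x
      rw [lmarginal_insert _ hf hi, lmarginal_insert _ hf hi]
      have hm : Measurable fun y => (∫⋯∫⁻_s, f ∂γ) (Function.update x i y) :=
        (hf.lmarginal γ).comp (measurable_update x)
      calc ∫⁻ y, (∫⋯∫⁻_s, f ∂μ) (Function.update x i y) ∂μ i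
          ≤ ∫⁻ y, (∫⋯∫⁻_s, f ∂γ) (Function.update x i y) + s.card * δ ∂μ i :=
            lintegral_mono fun y => ih _
        _ = ∫⁻ y, (∫⋯∫⁻_s, f ∂γ) (Function.update x i y) ∂μ i + s.card * δ := by
            rw [lintegral_add_left hm]; simp
        _ ≤ ∫⁻ y, (∫⋯∫⁻_s, f ∂γ) (Function.update x i y) ∂(γ i + ν i) + s.card * δ := by
            exact add_le_add_left (lintegral_mono' (h i) le_rfl) _
        _ ≤ (∫⁻ y, (∫⋯∫⁻_s, f ∂γ) (Function.update x i y) ∂γ i + δ) + s.card * δ := by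
            rw [lintegral_add_measure]
            gcongr
            calc _ ≤ ∫⁻ _, 1 ∂ν i := lintegral_mono fun y => hle _ _
              _ ≤ δ := by simpa using hν i
        _ = _ := by
            rw [Finset.card_insert_of_notMem hi]; push_cast; ring
  have : Nonempty (∀ i, X i) := by
    refine Classical.nonempty_pi.2 fun i => ?_
    exact nonempty_of_isProbabilityMeasure (μ i)
  obtain ⟨x⟩ := this
  rw [lintegral_eq_lmarginal_univ x, lintegral_eq_lmarginal_univ x]
  exact key Finset.univ x

end pi

/-- Selecting coordinates from independent vectors. -/
lemma map_select_pi {E J : Type*} [Fintype E] [Fintype J] {X : Type*} [MeasurableSpace X]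
    (μ : E → J → Measure X) [∀ e j, IsProbabilityMeasure (μ e j)] (f : J → E) :
    (Measure.pi fun e => Measure.pi (μ e)).map (fun w j => w (f j) j) =
      Measure.pi fun j => μ (f j) j := by
  classical
  refine (Measure.pi_eq fun s hs => ?_).symm
  rw [Measure.map_apply (by fun_prop) (.univ_pi hs)]
  have h : (fun (w : E → J → X) j => w (f j) j) ⁻¹' Set.univ.pi s =
      Set.univ.pi fun e => Set.univ.pi fun j => if f j = e then s j else Set.univ := by
    ext w
    simp only [Set.mem_preimage, Set.mem_pi, Set.mem_univ, true_implies]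
    constructor
    · intro h e j
      split_ifs with hj
      · subst hj; exact h j
      · trivial
    · intro h j
      simpa using h (f j) j
  rw [h, Measure.pi_pi]
  simp_rw [Measure.pi_pi]
  rw [Finset.prod_comm]
  refine Finset.prod_congr rfl fun j _ => ?_
  rw [Finset.prod_eq_single (f j)]
  · simp
  · intro e _ he
    simp [he.symm]
  · simp

lemma map_curry_pi {E J : Type*} [Fintype E] [Fintype J] {X : Type*} [MeasurableSpace X]
    (μ : E → J → Measure X) [∀ e j, IsProbabilityMeasure (μ e j)] :
    (Measure.pi fun p : E × J => μ p.1 p.2).map (fun y e j => y (e, j)) =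
      Measure.pi fun e => Measure.pi (μ e) := by
  have h : (Measure.pi fun e => Measure.pi (μ e)).map (fun (w : E → J → X) (p : E × J) => w p.1 p.2)
      = Measure.pi fun p : E × J => μ p.1 p.2 := by
    refine (Measure.pi_eq fun s hs => ?_).symm
    rw [Measure.map_apply (by fun_prop) (.univ_pi hs)]
    have h : (fun (w : E → J → X) (p : E × J) => w p.1 p.2) ⁻¹' Set.univ.pi s =
        Set.univ.pi fun e => Set.univ.pi fun j => s (e, j) := by
      ext w
      simp [Set.mem_pi]
    rw [h, Measure.pi_pi]
    simp_rw [Measure.pi_pi]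
    rw [Fintype.prod_prod_type]
  rw [← h, Measure.map_map (by fun_prop) (by fun_prop)]
  exact Measure.map_id

/-! ### Gaussian shifts -/

lemma gaussianReal_eq_withDensity (m : ℝ) :
    gaussianReal m 1 =
      (gaussianReal 0 1).withDensity fun z => ENNReal.ofReal (Real.exp (m * z - m ^ 2 / 2)) := by
  rw [gaussianReal_of_var_ne_zero m one_ne_zero, gaussianReal_of_var_ne_zero 0 one_ne_zero,
    ← withDensity_mul _ (measurable_gaussianPDF 0 1) (by fun_prop)]
  congr 1
  ext z
  simp only [Pi.mul_apply, gaussianPDF]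
  rw [← ENNReal.ofReal_mul (gaussianPDFReal_nonneg _ _ _)]
  congr 1
  simp only [gaussianPDFReal, NNReal.coe_one, mul_one, sub_zero]
  rw [mul_assoc, ← Real.exp_add]
  ring_nf

/-- Exponential moment of the log-likelihood ratio under the shifted law, for the Chernoff bound
below. -/
lemma lintegral_exp_gaussianReal (m q : ℝ) :
    ∫⁻ z, ENNReal.ofReal (Real.exp (q * (m * z - m ^ 2 / 2))) ∂gaussianReal m 1 =
      ENNReal.ofReal (Real.exp ((q ^ 2 + q) * m ^ 2 / 2)) := by
  have hrw : ∀ z : ℝ, Real.exp (q * (m * z - m ^ 2 / 2)) =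
      Real.exp ((q * m) * z) * Real.exp (-(q * m ^ 2 / 2)) := by
    intro z; rw [← Real.exp_add]; ring_nf
  rw [← ofReal_integral_eq_lintegral_ofReal]
  · congr 1
    simp_rw [hrw]
    rw [integral_mul_const]
    have := congr_fun (mgf_fun_id_gaussianReal (μ := m) (v := 1)) (q * m)
    simp only [mgf] at this
    rw [this, ← Real.exp_add]
    congr 1
    simp only [NNReal.coe_one]
    ring
  · simp_rw [hrw]
    exact (integrable_exp_mul_gaussianReal (q * m)).mul_const _
  · exact Filter.Eventually.of_forall fun z => (Real.exp_pos _).le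

/-- The Gaussian product measure with mean vector `m`. -/
noncomputable abbrev gaussianPi {J : Type*} [Fintype J] (m : J → ℝ) : Measure (J → ℝ) :=
  Measure.pi fun j => gaussianReal (m j) 1

lemma gaussianPi_eq_withDensity {J : Type*} [Fintype J] (m : J → ℝ) :
    gaussianPi m = (gaussianPi (fun _ : J => (0 : ℝ))).withDensity
      fun z => ENNReal.ofReal (Real.exp (∑ j, (m j * z j - m j ^ 2 / 2))) := by
  have (j : J) : IsProbabilityMeasure ((gaussianReal 0 1).withDensity
      fun z => ENNReal.ofReal (Real.exp (m j * z - m j ^ 2 / 2))) := by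
    rw [← gaussianReal_eq_withDensity]; infer_instance
  have h := pi_withDensity (fun _ : J => gaussianReal 0 1)
    (f := fun j z => ENNReal.ofReal (Real.exp (m j * z - m j ^ 2 / 2))) (fun j => by fun_prop)
  have e : (fun j => gaussianReal (m j) 1) = fun j => (gaussianReal 0 1).withDensity
      fun z => ENNReal.ofReal (Real.exp (m j * z - m j ^ 2 / 2)) :=
    funext fun j => gaussianReal_eq_withDensity (m j)
  rw [gaussianPi, e, h]
  congr 1
  ext z
  rw [Real.exp_sum, ENNReal.ofReal_prod_of_nonneg fun j _ => (Real.exp_pos _).le]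

/-- Outside an event that is unlikely for a short mean vector, the density of a shifted standard
Gaussian vector is at most two. -/
lemma exists_restrict_gaussianPi_le {J : Type*} [Fintype J] (m : J → ℝ) {σ : ℝ} (hσ : 0 < σ)
    (hm : ∑ j, m j ^ 2 ≤ σ) : ∃ B : Set (J → ℝ), MeasurableSet B ∧
      (gaussianPi m).restrict B ≤ (2 : ℝ≥0∞) • gaussianPi (fun _ : J => (0 : ℝ)) ∧
      gaussianPi m Bᶜ ≤ ENNReal.ofReal (Real.exp (1 / 4 - 1 / (5 * σ))) := by
  set L : (J → ℝ) → ℝ := fun z => ∑ j, (m j * z j - m j ^ 2 / 2) with hL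
  have hLm : Measurable L := by
    rw [hL]; fun_prop
  refine ⟨{z | L z ≤ Real.log 2}, measurableSet_le hLm measurable_const, ?_, ?_⟩
  · refine Measure.le_iff.2 fun s hs => ?_
    have hB : MeasurableSet {z | L z ≤ Real.log 2} := measurableSet_le hLm measurable_const
    rw [Measure.restrict_apply hs, gaussianPi_eq_withDensity m,
      withDensity_apply _ (hs.inter hB), Measure.smul_apply, smul_eq_mul]
    calc _ ≤ ∫⁻ _ in s ∩ {z | L z ≤ Real.log 2}, 2 ∂gaussianPi (fun _ : J => (0 : ℝ)) := by
          refine setLIntegral_mono measurable_const fun z hz => ?_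
          have h : L z ≤ Real.log 2 := hz.2
          calc ENNReal.ofReal (Real.exp (L z)) ≤ ENNReal.ofReal 2 := by
                refine ENNReal.ofReal_le_ofReal ?_
                rw [← Real.exp_log (by norm_num : (0 : ℝ) < 2)]
                exact Real.exp_le_exp.2 h
            _ = 2 := by simp
      _ = 2 * gaussianPi (fun _ : J => (0 : ℝ)) (s ∩ {z | L z ≤ Real.log 2}) := by simp
      _ ≤ _ := by gcongr; exact Set.inter_subset_left
  -- Chernoff bound with exponent `q`: the moment contributes `(q ^ 2 + q) * σ / 2 = q / 4 + 1 / 4`,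
  -- and `log 2 - 1 / 4 > 2 / 5` leaves `1 / 4 - 2 * q / 5`.
  · set q : ℝ := 1 / (2 * σ) with hq
    have hq0 : 0 < q := by positivity
    have h1 : ∀ z, z ∈ {z | L z ≤ Real.log 2}ᶜ → ENNReal.ofReal (Real.exp (q * Real.log 2)) ≤
        ENNReal.ofReal (Real.exp (q * L z)) := by
      intro z hz
      have : Real.log 2 < L z := by simpa using hz
      gcongr
    have h2 : ∫⁻ z, ENNReal.ofReal (Real.exp (q * L z)) ∂gaussianPi m =
        ENNReal.ofReal (Real.exp ((q ^ 2 + q) * (∑ j, m j ^ 2) / 2)) := by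
      have : ∀ z : J → ℝ, ENNReal.ofReal (Real.exp (q * L z)) =
          ∏ j, ENNReal.ofReal (Real.exp (q * (m j * z j - m j ^ 2 / 2))) := by
        intro z
        rw [hL, Finset.mul_sum, Real.exp_sum,
          ENNReal.ofReal_prod_of_nonneg fun j _ => (Real.exp_pos _).le]
      simp_rw [this]
      rw [lintegral_pi_prod _ (f := fun j y =>
        ENNReal.ofReal (Real.exp (q * (m j * y - m j ^ 2 / 2)))) (fun j => by fun_prop)]
      simp_rw [lintegral_exp_gaussianReal]
      rw [← ENNReal.ofReal_prod_of_nonneg fun j _ => (Real.exp_pos _).le, ← Real.exp_sum,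
        Finset.mul_sum, Finset.sum_div]
    have hlog : (0.6931 : ℝ) < Real.log 2 := lt_trans (by norm_num) Real.log_two_gt_d9
    have hne : ENNReal.ofReal (Real.exp (q * Real.log 2)) ≠ 0 := by
      simp [Real.exp_pos]
    have h3 := meas_ge_le_lintegral_div (μ := gaussianPi m)
      (f := fun z => ENNReal.ofReal (Real.exp (q * L z))) (by fun_prop) hne ENNReal.ofReal_ne_top
    refine ((measure_mono fun z hz => h1 z hz).trans h3).trans ?_
    rw [h2, ← ENNReal.ofReal_div_of_pos (Real.exp_pos _), ← Real.exp_sub]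
    refine ENNReal.ofReal_le_ofReal (Real.exp_le_exp.2 ?_)
    have h4 : (q ^ 2 + q) * (∑ j, m j ^ 2) / 2 ≤ (q ^ 2 + q) * σ / 2 := by gcongr
    have h5 : (q ^ 2 + q) * σ / 2 = q / 4 + 1 / 4 := by rw [hq]; field_simp; ring
    have h6 : 1 / (5 * σ) = q * (2 / 5) := by rw [hq]; field_simp
    rw [h6]
    nlinarith

/-- A probability measure `Q₀` such that `(Q₀ + Q) / 2` is close to `γ`. -/
lemma exists_complementary_measure {Ω : Type*} [MeasurableSpace Ω] (γ Q : Measure Ω)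
    [IsProbabilityMeasure γ] [IsProbabilityMeasure Q] {B : Set Ω} (hB : MeasurableSet B)
    (h : Q.restrict B ≤ (2 : ℝ≥0∞) • γ) : ∃ Q₀ : Measure Ω, IsProbabilityMeasure Q₀ ∧
      Q₀ + Q ≤ (2 : ℝ≥0∞) • γ + Q.restrict Bᶜ := by
  -- The mass of `D` is `2 - Q B ≥ 1`, so normalizing it only makes it smaller.
  set D : Measure Ω := (2 : ℝ≥0∞) • γ - Q.restrict B with hD
  have hadd : D + Q.restrict B = (2 : ℝ≥0∞) • γ := Measure.sub_add_cancel_of_le h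
  have huniv : D Set.univ + Q B = 2 := by
    have := congr_arg (fun μ : Measure Ω => μ Set.univ) hadd
    simpa using this
  have hD1 : 1 ≤ D Set.univ := by
    have hQ : Q B ≤ 1 := prob_le_one
    by_contra hlt
    push Not at hlt
    have : D Set.univ + Q B < 2 := by
      calc D Set.univ + Q B ≤ D Set.univ + 1 := by gcongr
        _ < 1 + 1 := ENNReal.add_lt_add_right (by simp) hlt
        _ = 2 := one_add_one_eq_two
    exact this.ne huniv
  have hDtop : D Set.univ ≠ ∞ := by
    intro htop
    rw [htop] at huniv
    simp at huniv
  refine ⟨(D Set.univ)⁻¹ • D, ⟨?_⟩, ?_⟩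
  · rw [Measure.smul_apply, smul_eq_mul]
    exact ENNReal.inv_mul_cancel (by positivity) hDtop
  · calc (D Set.univ)⁻¹ • D + Q ≤ D + Q := by
          gcongr
          refine Measure.le_iff.2 fun s _ => ?_
          rw [Measure.smul_apply, smul_eq_mul]
          calc (D Set.univ)⁻¹ * D s ≤ 1 * D s := by gcongr; exact ENNReal.inv_le_one.2 hD1
            _ = D s := one_mul _
      _ = D + (Q.restrict B + Q.restrict Bᶜ) := by rw [Measure.restrict_add_restrict_compl hB]
      _ = _ := by rw [← add_assoc, hadd]

/-! ### Amplification by voting -/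

/-- Hoeffding: votes in `[0, 1]` are sub-Gaussian with parameter `1 / 4`, and a deviation `R / 4` of
the sum gives `(R / 4) ^ 2 / (2 * (R / 4)) = R / 8`. -/
lemma pi_vote_ge_le {Ω : Type*} [MeasurableSpace Ω] (ν : Measure Ω) [IsProbabilityMeasure ν]
    {f : Ω → Bool} (hf : Measurable f) (R : ℕ) {p : ℝ} (hp : ν.real {ω | f ω = true} ≤ p) :
    Measure.pi (fun _ : Fin R => ν)
        {ω | (p + 1 / 4) * R ≤ ∑ r, if f (ω r) then (1 : ℝ) else 0} ≤
      ENNReal.ofReal (Real.exp (-(R / 8))) := by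
  set X : Ω → ℝ := fun ω => if f ω then 1 else 0 with hX
  have hS : MeasurableSet {ω | f ω = true} := hf (measurableSet_singleton true)
  have hXm : Measurable X := Measurable.ite hS measurable_const measurable_const
  have hXint : ν[X] = ν.real {ω | f ω = true} := by
    have : X = Set.indicator {ω | f ω = true} 1 := by
      ext ω; by_cases h : f ω = true <;> simp [hX, h]
    rw [this, integral_indicator_one hS]
  have hsub : HasSubgaussianMGF (fun ω => X ω - ν[X]) ((‖(1 : ℝ) - 0‖₊ / 2) ^ 2) ν := by
    refine hasSubgaussianMGF_of_mem_Icc hXm.aemeasurable (Filter.Eventually.of_forall fun ω => ?_)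
    simp only [hX]
    split_ifs <;> simp
  have hind : iIndepFun (fun (r : Fin R) (ω : Fin R → Ω) => X (ω r) - ν[X])
      (Measure.pi fun _ : Fin R => ν) :=
    iIndepFun_pi (X := fun _ ω => X ω - ν[X]) fun r => (hXm.sub_const _).aemeasurable
  have hsub' : ∀ r ∈ (Finset.univ : Finset (Fin R)), HasSubgaussianMGF
      (fun ω : Fin R → Ω => X (ω r) - ν[X]) ((‖(1 : ℝ) - 0‖₊ / 2) ^ 2)
      (Measure.pi fun _ : Fin R => ν) := by
    intro r _
    refine HasSubgaussianMGF.of_map (X := fun ω => X ω - ν[X]) (Y := fun ω : Fin R → Ω => ω r)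
      (measurable_pi_apply r).aemeasurable ?_
    rw [(measurePreserving_eval (fun _ : Fin R => ν) r).map_eq]
    exact hsub
  have h := HasSubgaussianMGF.measure_sum_ge_le_of_iIndepFun hind hsub' (ε := R / 4) (by positivity)
  have hexp : -((R : ℝ) / 4) ^ 2 / (2 * ∑ _r : Fin R, (((‖(1 : ℝ) - 0‖₊ / 2) ^ 2 : NNReal) : ℝ)) =
      -(R / 8) := by
    rcases Nat.eq_zero_or_pos R with rfl | hR
    · simp
    · have : (R : ℝ) ≠ 0 := by positivity
      simp
      field_simp
      norm_num
  rw [NNReal.coe_sum, hexp] at h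
  rw [← ofReal_measureReal (measure_ne_top _ _)]
  refine ENNReal.ofReal_le_ofReal (le_trans (measureReal_mono (fun ω hω => ?_)) h)
  simp only [Set.mem_ofPred_eq] at hω ⊢
  rw [Finset.sum_sub_distrib, hXint]
  simp only [Finset.sum_const, Finset.card_univ, Fintype.card_fin, nsmul_eq_mul]
  have : (R : ℝ) * ν.real {ω | f ω = true} ≤ R * p := by gcongr
  have e : ∑ r, X (ω r) = ∑ r, if f (ω r) then (1 : ℝ) else 0 := rfl
  rw [e]
  linarith

/-- The upper-tail bound applied to the negated votes, whose mean is at most `1 / 2 - p`. -/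
lemma pi_vote_lt_le {Ω : Type*} [MeasurableSpace Ω] (ν : Measure Ω) [IsProbabilityMeasure ν]
    {f : Ω → Bool} (hf : Measurable f) (R : ℕ) {p : ℝ}
    (hp : p + 1 / 2 ≤ ν.real {ω | f ω = true}) :
    Measure.pi (fun _ : Fin R => ν)
        {ω | (∑ r, if f (ω r) then (1 : ℝ) else 0) < (p + 1 / 4) * R} ≤
      ENNReal.ofReal (Real.exp (-(R / 8))) := by
  have hS : MeasurableSet {ω | f ω = true} := hf (measurableSet_singleton true)
  have hc : {ω | (!f ω) = true} = {ω | f ω = true}ᶜ := by ext ω; simp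
  have h1 : ν.real {ω | (!f ω) = true} ≤ 1 / 2 - p := by
    rw [hc, probReal_compl_eq_one_sub hS]; linarith
  have hf' : Measurable fun ω => !f ω := (measurable_of_countable fun b : Bool => !b).comp hf
  refine (measure_mono fun ω hω => ?_).trans (pi_vote_ge_le ν hf' R h1)
  simp only [Set.mem_ofPred_eq] at hω ⊢
  have : (∑ r, if (!f (ω r)) = true then (1 : ℝ) else 0) +
      (∑ r, if f (ω r) then (1 : ℝ) else 0) = R := by
    rw [← Finset.sum_add_distrib]
    calc _ = ∑ _r : Fin R, (1 : ℝ) := Finset.sum_congr rfl fun r _ => by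
            cases f (ω r) <;> simp
      _ = R := by simp
  linarith

/-! ### From independent fair bits to Gaussian vectors -/

/-- The fair coin. -/
noncomputable abbrev fairBit : Measure Bool := (PMF.uniformOfFintype Bool).toMeasure

/-- Here `s` tells whether planting forces the bit to be one. -/
lemma map_mixture {Z : Type*} [MeasurableSpace Z] (Q₀ Q₁ : Measure Z) [IsProbabilityMeasure Q₀]
    [IsProbabilityMeasure Q₁] (s : Bool) :
    (fairBit.prod (Q₀.prod Q₁)).map (fun q => if s || q.1 then q.2.2 else q.2.1) =
      if s then Q₁ else (2 : ℝ≥0∞)⁻¹ • (Q₀ + Q₁) := by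
  have hm : Measurable fun q : Bool × Z × Z => if s || q.1 then q.2.2 else q.2.1 := by
    refine Measurable.ite ?_ (by fun_prop) (by fun_prop)
    exact ((measurable_of_countable fun b : Bool => s || b).comp measurable_fst)
      (measurableSet_singleton true)
  ext t ht
  rw [Measure.map_apply hm ht, Measure.prod_apply (hm ht), lintegral_fintype]
  have h1 : ∀ b : Bool, fairBit {b} = 2⁻¹ := by
    intro b
    rw [PMF.toMeasure_apply_singleton _ _ (measurableSet_singleton b)]
    simp
  have hA : (Q₀.prod Q₁) {q : Z × Z | q.2 ∈ t} = Q₁ t := by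
    have : {q : Z × Z | q.2 ∈ t} = Set.univ ×ˢ t := by ext; simp
    rw [this, Measure.prod_prod]; simp
  have hB : (Q₀.prod Q₁) {q : Z × Z | q.1 ∈ t} = Q₀ t := by
    have : {q : Z × Z | q.1 ∈ t} = t ×ˢ Set.univ := by ext; simp
    rw [this, Measure.prod_prod]; simp
  simp only [Fintype.sum_bool, h1]
  cases s
  · simp only [Bool.false_or, Set.preimage, Set.mem_ofPred_eq, if_true, Bool.false_eq_true, if_false,
      hA, hB, Measure.smul_apply, Measure.add_apply, smul_eq_mul]
    ring
  · simp only [Bool.true_or, Set.preimage, Set.mem_ofPred_eq, if_true, hA]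
    rw [← mul_add, ENNReal.inv_two_add_inv_two, mul_one]

lemma map_mixture_pi {E Z : Type*} [Fintype E] [MeasurableSpace Z] (Q₀ Q₁ : E → Measure Z)
    [∀ e, IsProbabilityMeasure (Q₀ e)] [∀ e, IsProbabilityMeasure (Q₁ e)] (s : E → Bool) :
    ((Measure.pi fun _ : E => fairBit).prod (Measure.pi fun e => (Q₀ e).prod (Q₁ e))).map
        (fun q e => if s e || q.1 e then (q.2 e).2 else (q.2 e).1) =
      Measure.pi fun e => if s e then Q₁ e else (2 : ℝ≥0∞)⁻¹ • (Q₀ e + Q₁ e) := by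
  have hm : ∀ s : Bool, Measurable fun q : Bool × Z × Z => if s || q.1 then q.2.2 else q.2.1 := by
    intro s
    refine Measurable.ite ?_ (by fun_prop) (by fun_prop)
    exact ((measurable_of_countable fun b : Bool => s || b).comp measurable_fst)
      (measurableSet_singleton true)
  have hmp := measurePreserving_arrowProdEquivProdArrow Bool (Z × Z) E (fun _ => fairBit)
    fun e => (Q₀ e).prod (Q₁ e)
  have hm2 : Measurable fun (q : (E → Bool) × (E → Z × Z)) e =>
      if s e || q.1 e then (q.2 e).2 else (q.2 e).1 := by
    refine measurable_pi_iff.2 fun e => ?_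
    exact (hm (s e)).comp (by fun_prop : Measurable fun q : (E → Bool) × (E → Z × Z) =>
      (q.1 e, q.2 e))
  rw [← hmp.map_eq, Measure.map_map hm2 hmp.measurable]
  have (e : E) : IsProbabilityMeasure ((fairBit.prod ((Q₀ e).prod (Q₁ e))).map
      (fun q => if s e || q.1 then q.2.2 else q.2.1)) :=
    Measure.isProbabilityMeasure_map (hm _).aemeasurable
  have h := Measure.pi_map_pi (μ := fun e => fairBit.prod ((Q₀ e).prod (Q₁ e)))
    (f := fun e q => if s e || q.1 then q.2.2 else q.2.1) (fun e => (hm _).aemeasurable)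
  simp_rw [map_mixture] at h
  exact h

/-- `Q₀` is the law to sample from when the bit is zero; `ν` bounds the excess over the standard
Gaussian and lives on the event where the density ratio exceeds two. -/
lemma exists_gaussian_complement {J : Type*} [Fintype J] (m : J → ℝ) {σ : ℝ} (hσ : 0 < σ)
    (hm : ∑ j, m j ^ 2 ≤ σ) : ∃ Q₀ ν : Measure (J → ℝ), IsProbabilityMeasure Q₀ ∧
      (2 : ℝ≥0∞)⁻¹ • (Q₀ + gaussianPi m) ≤ gaussianPi (fun _ => 0) + ν ∧
      ν Set.univ ≤ ENNReal.ofReal (Real.exp (1 / 4 - 1 / (5 * σ))) := by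
  obtain ⟨B, hB, h1, h2⟩ := exists_restrict_gaussianPi_le m hσ hm
  obtain ⟨Q₀, hQ₀, h⟩ := exists_complementary_measure _ _ hB h1
  refine ⟨Q₀, (2 : ℝ≥0∞)⁻¹ • (gaussianPi m).restrict Bᶜ, hQ₀, ?_, ?_⟩
  · calc _ ≤ (2 : ℝ≥0∞)⁻¹ • ((2 : ℝ≥0∞) • gaussianPi (fun _ : J => (0 : ℝ)) +
          (gaussianPi m).restrict Bᶜ) := by
          refine Measure.le_iff.2 fun s _ => ?_
          rw [Measure.smul_apply, Measure.smul_apply, smul_eq_mul, smul_eq_mul]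
          gcongr
      _ = _ := by
          rw [smul_add, smul_smul, ENNReal.inv_mul_cancel two_ne_zero ENNReal.ofNat_ne_top,
            one_smul]
  · rw [Measure.smul_apply, Measure.restrict_apply_univ, smul_eq_mul]
    calc _ ≤ 1 * gaussianPi m Bᶜ := by
          gcongr; exact ENNReal.inv_le_one.2 one_le_two
      _ ≤ _ := by rwa [one_mul]

/-- The vectors that `R` copies of a tensor are built from, by choosing for each entry `j` one of
the values `(q (f j)).1 (r, j)` and `(q (f j)).2 (r, j)` according to the bit `f j`. -/
abbrev Seed (E J : Type*) (R : ℕ) : Type _ := E → (Fin R × J → ℝ) × (Fin R × J → ℝ)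

/-- The copies of the tensor built from the bits `G` and the seed `q`. -/
noncomputable def bitTensor {E J : Type*} {R : ℕ} (f : J → E) (G : E → Bool) (q : Seed E J R)
    (r : Fin R) (j : J) : ℝ :=
  if G (f j) then (q (f j)).2 (r, j) else (q (f j)).1 (r, j)

lemma measurable_bitTensor {E J : Type*} [Fintype E] [Fintype J] {R : ℕ} (f : J → E)
    (s : E → Bool) :
    Measurable fun q : (E → Bool) × Seed E J R => bitTensor f (fun e => s e || q.1 e) q.2 := by
  refine measurable_pi_iff.2 fun r => measurable_pi_iff.2 fun j => ?_
  refine Measurable.ite ?_ (by fun_prop) (by fun_prop)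
  exact ((measurable_of_countable fun b : Bool => s (f j) || b).comp
    ((measurable_pi_apply (f j)).comp measurable_fst)) (measurableSet_singleton true)

/-- Tensors built from fair bits, some of which are replaced by `true`, are nearly standard
Gaussian with a shift at those entries that belong to the replaced bits. -/
lemma exists_seedLaw {E J T : Type*} [Fintype E] [DecidableEq E] [Fintype J] [MeasurableSpace T]
    (R : ℕ) (f : J → E) (m : J → ℝ) {σ : ℝ} (hσ : 0 < σ)
    (hm : ∀ e, R * ∑ j, (if f j = e then m j else 0) ^ 2 ≤ σ)
    (ρ : Measure T) [IsProbabilityMeasure ρ] :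
    ∃ D : Measure (Seed E J R), IsProbabilityMeasure D ∧ ∀ (s : E → Bool)
      (W : Set (Fin R → (J → ℝ) × T)), MeasurableSet W →
      ((Measure.pi fun _ : E => fairBit).prod (D.prod (Measure.pi fun _ : Fin R => ρ)))
          {q | (fun r => (bitTensor f (fun e => s e || q.1 e) q.2.1 r, q.2.2 r)) ∈ W} ≤
        Measure.pi (fun _ : Fin R => (gaussianPi fun j => if s (f j) then m j else 0).prod ρ) W +
          Fintype.card E * ENNReal.ofReal (Real.exp (1 / 4 - 1 / (5 * σ))) := by
  classical
  -- All entries of all copies governed by one bit depend on each other through it, so they are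
  -- treated as one vector; its whole squared shift has to be small.
  have hm' : ∀ e, ∑ p : Fin R × J, (if f p.2 = e then m p.2 else 0) ^ 2 ≤ σ := by
    intro e
    rw [Fintype.sum_prod_type]
    simpa using hm e
  choose Q₀ ν hQ₀ hle hν using fun e =>
    exists_gaussian_complement (fun p : Fin R × J => if f p.2 = e then m p.2 else 0) hσ (hm' e)
  set Q₁ : E → Measure (Fin R × J → ℝ) := fun e =>
    gaussianPi (fun p : Fin R × J => if f p.2 = e then m p.2 else 0) with hQ₁
  refine ⟨Measure.pi fun e => (Q₀ e).prod (Q₁ e), inferInstance, fun s W hW => ?_⟩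
  set P := Measure.pi fun _ : E => fairBit
  set D := Measure.pi fun e => (Q₀ e).prod (Q₁ e)
  set ρR := Measure.pi fun _ : Fin R => ρ
  -- the event in terms of the chosen vectors
  set Φ : (E → Fin R × J → ℝ) × (Fin R → T) → Fin R → (J → ℝ) × T :=
    fun q r => (fun j => q.1 (f j) (r, j), q.2 r) with hΦ
  have hΦm : Measurable Φ := by
    rw [hΦ]
    refine measurable_pi_iff.2 fun r => ?_
    fun_prop
  set ch : (E → Bool) × Seed E J R → E → Fin R × J → ℝ :=
    fun q e => if s e || q.1 e then (q.2 e).2 else (q.2 e).1 with hch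
  have hchm : Measurable ch := by
    refine measurable_pi_iff.2 fun e => ?_
    refine Measurable.ite ?_ (by fun_prop) (by fun_prop)
    exact ((measurable_of_countable fun b : Bool => s e || b).comp
      ((measurable_pi_apply e).comp measurable_fst)) (measurableSet_singleton true)
  have hev : ∀ q : (E → Bool) × Seed E J R × (Fin R → T),
      (fun r => (bitTensor f (fun e => s e || q.1 e) q.2.1 r, q.2.2 r)) =
        Φ (ch (q.1, q.2.1), q.2.2) := by
    intro q
    ext r j
    · simp only [bitTensor, hΦ, hch]
      split_ifs <;> rfl
    · rfl
  set μ : E → Measure (Fin R × J → ℝ) := fun e =>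
    if s e then Q₁ e else (2 : ℝ≥0∞)⁻¹ • (Q₀ e + Q₁ e) with hμ
  have hμlaw : (P.prod D).map ch = Measure.pi μ := map_mixture_pi Q₀ Q₁ s
  have hμp : ∀ e, IsProbabilityMeasure (μ e) := by
    intro e
    rw [hμ]
    dsimp only
    split_ifs
    · infer_instance
    · refine ⟨?_⟩
      rw [Measure.smul_apply, Measure.add_apply, measure_univ, measure_univ, one_add_one_eq_two,
        smul_eq_mul, ENNReal.inv_mul_cancel two_ne_zero ENNReal.ofNat_ne_top]
  -- The target laws. Replaced bits reach them exactly; only fair bits incur the excess `ν e`.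
  -- Coordinates `p` with `f p.2 ≠ e` are never read from the vector of `e`.
  set γ : E → Measure (Fin R × J → ℝ) := fun e =>
    gaussianPi (fun p : Fin R × J => if s e ∧ f p.2 = e then m p.2 else 0) with hγ
  have hμγ : ∀ e, μ e ≤ γ e + ν e := by
    intro e
    simp only [hμ, hγ]
    by_cases h : s e = true
    · simp only [h, if_true, true_and]
      exact Measure.le_add_right le_rfl
    · simp only [h, if_false, false_and, Bool.false_eq_true]
      exact hle e
  set g : (E → Fin R × J → ℝ) → ℝ≥0∞ := fun w => ρR (Prod.mk w ⁻¹' (Φ ⁻¹' W)) with hg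
  have hgm : Measurable g := measurable_measure_prodMk_left (hΦm hW)
  have h1 : (P.prod (D.prod ρR))
      {q | (fun r => (bitTensor f (fun e => s e || q.1 e) q.2.1 r, q.2.2 r)) ∈ W} =
      ∫⁻ w, g w ∂Measure.pi μ := by
    simp_rw [hev]
    rw [← hμlaw, lintegral_map hgm hchm]
    have hassoc := (measurePreserving_prodAssoc P D ρR).map_eq
    have hmeas : MeasurableSet {q : (E → Bool) × Seed E J R × (Fin R → T) |
        Φ (ch (q.1, q.2.1), q.2.2) ∈ W} := by
      refine (hΦm.comp ?_) hW
      exact (hchm.comp (by fun_prop : Measurable fun q : (E → Bool) × Seed E J R × (Fin R → T) =>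
        (q.1, q.2.1))).prodMk (by fun_prop)
    rw [← hassoc, Measure.map_apply MeasurableEquiv.prodAssoc.measurable hmeas,
      Measure.prod_apply (MeasurableEquiv.prodAssoc.measurable hmeas)]
    rfl
  have h2 : ∫⁻ w, g w ∂Measure.pi γ =
      Measure.pi (fun _ : Fin R => (gaussianPi fun j => if s (f j) then m j else 0).prod ρ) W := by
    rw [hg, ← Measure.prod_apply (hΦm hW)]
    have hsel := map_select_pi (fun e (p : Fin R × J) =>
      gaussianReal (if s e ∧ f p.2 = e then m p.2 else 0) 1) fun p : Fin R × J => f p.2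
    have hcur := map_curry_pi fun (_ : Fin R) (j : J) => gaussianReal (if s (f j) then m j else 0) 1
    simp only [and_true] at hsel
    rw [← hsel, Measure.map_map (by fun_prop) (by fun_prop)] at hcur
    have hzip := (measurePreserving_arrowProdEquivProdArrow (J → ℝ) T (Fin R)
      (fun _ => gaussianPi fun j => if s (f j) then m j else 0) fun _ => ρ).symm.map_eq
    rw [← hzip, ← hcur]
    have hid : ρR = ρR.map id := Measure.map_id.symm
    conv_rhs => rw [show (Measure.pi fun _ : Fin R => ρ) = ρR.map id from hid]
    rw [Measure.map_prod_map _ _ (by fun_prop) measurable_id,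
      Measure.map_map (MeasurableEquiv.measurable _) (by fun_prop), Measure.map_apply _ hW]
    · rfl
    · exact (MeasurableEquiv.measurable _).comp (by fun_prop)
  rw [h1, ← h2]
  exact lintegral_pi_le_add μ γ ν hμγ hν hgm fun w => prob_le_one

/-! ### Tests for hypergraphs from tests for tensors -/

instance {ι : Type} (P : Program ι) : IsProbabilityMeasure P.randomness := by
  unfold Program.randomness; infer_instance

lemma observationLaw_eq {d : ℕ} {n : Fin d → ℕ} (X : Tensor n) :
    observationLaw X = gaussianPi X := by
  have (j : ∀ i, Fin (n i)) : IsProbabilityMeasure ((gaussianReal 0 1).map fun z => X j + z) :=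
    Measure.isProbabilityMeasure_map (by fun_prop)
  have h := Measure.pi_map_pi (μ := fun _ : ∀ i, Fin (n i) => gaussianReal 0 1)
    (f := fun j z => X j + z) fun j => by fun_prop
  simp_rw [gaussianReal_map_const_add, zero_add] at h
  exact h

lemma Program.measurable_output_prod {ι : Type} (P : Program ι) :
    Measurable fun y : (ι → ℝ) × (Fin P.coins → Bool) × (Fin P.normals → ℝ) =>
      P.output y.1 y.2.1 y.2.2 :=
  P.measurable_output measurable_fst (by fun_prop) (by fun_prop)

/-- The error of a vote over `R` copies of a tensor built from `M` bits, when the squared norm of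
the shift that is carried by one bit is at most `σ`. -/
noncomputable def voteError (R M : ℕ) (σ : ℝ) : ℝ≥0∞ :=
  ENNReal.ofReal (Real.exp (-(R / 8))) +
    M * ENNReal.ofReal (Real.exp (1 / 4 - 1 / (5 * σ)))

/-- The type-I error and the weighted type-II errors are averaged together over the seed and the
randomness of `P`, so that one fixed outcome is good for their sum. The family `𝒦` holds the cliques
that this particular way of cutting has to detect. -/
lemma exists_vote {d N : ℕ} {J : Type} [Fintype J] (P : Program J) {p : ℝ} (R : ℕ)
    (f : J → {e : Finset (Fin N) // e.card = d}) (v : J → Fin d → Fin N)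
    (hv : ∀ G j, adjacency G (v j) = if G (f j) then 1 else 0) (m : J → ℝ) {σ : ℝ} (hσ : 0 < σ)
    (hm : ∀ e, R * ∑ j, (if f j = e then m j else 0) ^ 2 ≤ σ)
    (h0 : ((gaussianPi fun _ : J => (0 : ℝ)).prod P.randomness).real
      {y | P.output y.1 y.2.1 y.2.2 = true} ≤ p)
    (𝒦 : Finset (Finset (Fin N))) (w : ℝ≥0∞)
    (h1 : ∀ K ∈ 𝒦, p + 1 / 2 ≤ ((gaussianPi fun j => if decide ((f j).1 ⊆ K) = true then m j
      else 0).prod P.randomness).real {y | P.output y.1 y.2.1 y.2.2 = true}) :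
    ∃ F : ((Fin d → Fin N) → ℝ) → ℝ, Evaluable F (R * (7 * P.time + 6) + 5) ∧ (∀ x, 0 ≤ F x) ∧
      erdosRenyi d N {G | 0 < F (adjacency G)} +
        ∑ K ∈ 𝒦, w * erdosRenyi d N {G | ¬ 0 < F (adjacency (plant K G))} ≤
      (1 + 𝒦.card * w) *
        voteError R (Fintype.card {e : Finset (Fin N) // e.card = d}) σ := by
  obtain ⟨D, hD, hlaw⟩ := exists_seedLaw R f m hσ hm P.randomness
  -- Midway between the expected numbers of votes `p * R` and `(p + 1 / 2) * R`.
  set θ : ℝ := (p + 1 / 4) * R with hθ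
  set out : (J → ℝ) × (Fin P.coins → Bool) × (Fin P.normals → ℝ) → Bool := fun y => P.output y.1 y.2.1 y.2.2 with hout
  have houtm : Measurable out := P.measurable_output_prod
  set cnt : (Fin R → (J → ℝ) × (Fin P.coins → Bool) × (Fin P.normals → ℝ)) → ℝ := fun y => ∑ r, if out (y r) then 1 else 0 with hcnt
  have hcntm : Measurable cnt := Finset.measurable_sum _ fun r _ =>
    Measurable.ite ((houtm.comp (measurable_pi_apply r)) (measurableSet_singleton true))
      measurable_const measurable_const
  set W₁ : Set (Fin R → (J → ℝ) × (Fin P.coins → Bool) × (Fin P.normals → ℝ)) := {y | θ ≤ cnt y} with hW₁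
  set W₀ : Set (Fin R → (J → ℝ) × (Fin P.coins → Bool) × (Fin P.normals → ℝ)) := {y | cnt y < θ} with hW₀
  have hW₁m : MeasurableSet W₁ := measurableSet_le measurable_const hcntm
  have hW₀m : MeasurableSet W₀ := measurableSet_lt hcntm measurable_const
  -- the copies built from the bits
  set Y : Hypergraph d N → Seed {e : Finset (Fin N) // e.card = d} J R × (Fin R → (Fin P.coins → Bool) × (Fin P.normals → ℝ)) → Fin R → (J → ℝ) × (Fin P.coins → Bool) × (Fin P.normals → ℝ) :=
    fun G ω r => (bitTensor f G ω.1 r, ω.2 r) with hY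
  have hYm : ∀ s : Hypergraph d N, Measurable fun q : Hypergraph d N × Seed {e : Finset (Fin N) // e.card = d} J R × (Fin R → (Fin P.coins → Bool) × (Fin P.normals → ℝ)) =>
      Y (fun e => s e || q.1 e) q.2 := by
    intro s
    refine measurable_pi_iff.2 fun r => ?_
    refine Measurable.prodMk ?_ (by fun_prop)
    exact (measurable_pi_apply r).comp ((measurable_bitTensor f s).comp
      (by fun_prop : Measurable fun q : Hypergraph d N × Seed {e : Finset (Fin N) // e.card = d} J R × (Fin R → (Fin P.coins → Bool) × (Fin P.normals → ℝ)) => (q.1, q.2.1)))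
  set S := D.prod (Measure.pi fun _ : Fin R => P.randomness) with hS
  set ε := voteError R (Fintype.card {e : Finset (Fin N) // e.card = d}) σ with hε
  have hgen : ∀ (s : Hypergraph d N) (W : Set (Fin R → (J → ℝ) × (Fin P.coins → Bool) × (Fin P.normals → ℝ))), MeasurableSet W →
      Measure.pi (fun _ : Fin R =>
        (gaussianPi fun j => if s (f j) then m j else 0).prod P.randomness) W ≤
        ENNReal.ofReal (Real.exp (-(R / 8))) →
      Measurable (fun ω => erdosRenyi d N {G | Y (fun e => s e || G e) ω ∈ W}) ∧
      ∫⁻ ω, erdosRenyi d N {G | Y (fun e => s e || G e) ω ∈ W} ∂S ≤ ε := by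
    intro s W hW hle
    have hms : MeasurableSet {q : Hypergraph d N × Seed {e : Finset (Fin N) // e.card = d} J R × (Fin R → (Fin P.coins → Bool) × (Fin P.normals → ℝ)) |
        Y (fun e => s e || q.1 e) q.2 ∈ W} := hYm s hW
    refine ⟨measurable_measure_prodMk_right hms, ?_⟩
    have h := hlaw s W hW
    rw [show ∫⁻ ω, erdosRenyi d N {G | Y (fun e => s e || G e) ω ∈ W} ∂S =
      ((erdosRenyi d N).prod S) {q | Y (fun e => s e || q.1 e) q.2 ∈ W} from
        (Measure.prod_apply_symm hms).symm]
    refine h.trans ?_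
    rw [hε, voteError]
    gcongr
  have hnull := hgen (fun _ => false) W₁ hW₁m (by
    simp only [Bool.false_eq_true, if_false]
    exact pi_vote_ge_le _ houtm R h0)
  have halt : ∀ K ∈ 𝒦, _ := fun K hK => hgen (fun e => decide (e.1 ⊆ K)) W₀ hW₀m
    (pi_vote_lt_le _ houtm R (h1 K hK))
  set b : Seed {e : Finset (Fin N) // e.card = d} J R × (Fin R → (Fin P.coins → Bool) × (Fin P.normals → ℝ)) → ℝ≥0∞ := fun ω =>
    erdosRenyi d N {G | Y (fun e => false || G e) ω ∈ W₁} +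
      ∑ K ∈ 𝒦, w * erdosRenyi d N {G | Y (fun e => decide (e.1 ⊆ K) || G e) ω ∈ W₀} with hb
  have hbint : ∫⁻ ω, b ω ∂S ≤ (1 + 𝒦.card * w) * ε := by
    rw [hb, lintegral_add_left hnull.1,
      lintegral_finsetSum' _ fun K hK => ((halt K hK).1.const_mul w).aemeasurable]
    have : ∀ K ∈ 𝒦, ∫⁻ ω, w * erdosRenyi d N
        {G | Y (fun e => decide (e.1 ⊆ K) || G e) ω ∈ W₀} ∂S ≤ w * ε := by
      intro K hK
      rw [lintegral_const_mul _ (halt K hK).1]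
      gcongr
      exact (halt K hK).2
    calc _ ≤ ε + ∑ K ∈ 𝒦, w * ε := add_le_add hnull.2 (Finset.sum_le_sum this)
      _ = _ := by rw [Finset.sum_const, nsmul_eq_mul]; ring
  have hbm : AEMeasurable b S := by
    refine (hnull.1.add ?_).aemeasurable
    exact Finset.measurable_sum _ fun K hK => (halt K hK).1.const_mul w
  -- Derandomization: some outcome does no worse than the average, and it is wired into the program.
  obtain ⟨ω, hω⟩ := exists_le_lintegral hbm
  refine ⟨fun x => if θ ≤ ∑ r, (if P.output (fun j => (ω.1 (f j)).1 (r, j) +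
      x (v j) * ((ω.1 (f j)).2 (r, j) - (ω.1 (f j)).1 (r, j))) (ω.2 r).1 (ω.2 r).2 then 1 else 0)
      then 1 else 0, ?_, fun x => by positivity, ?_⟩
  · have := (Evaluable.sum (Finset.univ : Finset (Fin R)) fun r _ =>
      P.evaluable_output_subst (ι := Fin d → Fin N) (ω.2 r).1 (ω.2 r).2
        (fun j => (ω.1 (f j)).1 (r, j))
        (fun j => (ω.1 (f j)).2 (r, j) - (ω.1 (f j)).1 (r, j)) v).ite_le θ
    simpa using this
  · have hF : ∀ G : Hypergraph d N, (0 : ℝ) < (if θ ≤ ∑ r, (if P.output (fun j =>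
        (ω.1 (f j)).1 (r, j) + adjacency G (v j) * ((ω.1 (f j)).2 (r, j) - (ω.1 (f j)).1 (r, j)))
        (ω.2 r).1 (ω.2 r).2 then 1 else 0) then 1 else 0) ↔ Y G ω ∈ W₁ := by
      intro G
      have : ∀ r, (fun j => (ω.1 (f j)).1 (r, j) + adjacency G (v j) *
          ((ω.1 (f j)).2 (r, j) - (ω.1 (f j)).1 (r, j))) = bitTensor f G ω.1 r := by
        intro r
        ext j
        rw [hv, bitTensor]
        split_ifs <;> ring
      simp_rw [this]
      have e : (∑ r, if P.output (bitTensor f G ω.1 r) (ω.2 r).1 (ω.2 r).2 then (1 : ℝ) else 0) =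
        cnt (Y G ω) := rfl
      rw [e]
      change _ ↔ θ ≤ cnt (Y G ω)
      split_ifs with h <;> simp [h]
    refine le_trans (le_of_eq ?_) (hω.trans hbint)
    simp_rw [hF]
    rw [hb]
    simp only [Bool.false_or]
    congr 1
    refine Finset.sum_congr rfl fun K _ => ?_
    congr 2
    ext G
    simp only [Set.mem_ofPred_eq, hW₁, hW₀, not_le]
    rfl

lemma measurable_adjacency {d N : ℕ} :
    Measurable (adjacency : Hypergraph d N → (Fin d → Fin N) → ℝ) :=
  measurable_of_countable _

lemma plantedClique_map_adjacency_apply {d N κ : ℕ} {S : Set ((Fin d → Fin N) → ℝ)}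
    (hS : MeasurableSet S) : ((plantedClique d N κ).map adjacency) S =
      ∑ K ∈ Finset.powersetCard κ (Finset.univ : Finset (Fin N)),
        (N.choose κ : ℝ≥0∞)⁻¹ * erdosRenyi d N {G | adjacency (plant K G) ∈ S} := by
  rw [Measure.map_apply measurable_adjacency hS, plantedClique, Measure.finsetSum_apply]
  refine Finset.sum_congr rfl fun K _ => ?_
  rw [Measure.smul_apply, smul_eq_mul,
    Measure.map_apply (measurable_of_countable _) (measurable_adjacency hS)]
  rfl

/-- The risk of the test that decides whether `F` is positive. -/
lemma hpcRisk_eq {d N κ : ℕ} {F : ((Fin d → Fin N) → ℝ) → ℝ} {ψ : Program (Fin d → Fin N)}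
    (hψ : ∀ x c z, ψ.output x c z = decide (0 < F x)) :
    hpcRisk d N κ ψ = erdosRenyi d N {G | 0 < F (adjacency G)} +
      ∑ K ∈ Finset.powersetCard κ (Finset.univ : Finset (Fin N)),
        (N.choose κ : ℝ≥0∞)⁻¹ * erdosRenyi d N {G | ¬ 0 < F (adjacency (plant K G))} := by
  have hmeas : ∀ o : Bool, MeasurableSet {x | decide (0 < F x) = o} := by
    intro o
    have h := ψ.measurable_output (Ω := (Fin d → Fin N) → ℝ) (c := fun _ _ => true)
      (z := fun _ _ => 0) measurable_id measurable_const measurable_const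
    simp only [hψ] at h
    exact h (measurableSet_singleton o)
  have hout : ∀ (μ : Measure ((Fin d → Fin N) → ℝ)) [SFinite μ] (o : Bool),
      ψ.outputProb μ o = μ {x | decide (0 < F x) = o} := by
    intro μ _ o
    rw [Program.outputProb]
    have : {q : ((Fin d → Fin N) → ℝ) × (Fin ψ.coins → Bool) × (Fin ψ.normals → ℝ) |
        ψ.output q.1 q.2.1 q.2.2 = o} = {x | decide (0 < F x) = o} ×ˢ Set.univ := by
      ext q; simp [hψ]
    rw [this, Measure.prod_prod, measure_univ, mul_one]
  have hER : IsProbabilityMeasure (erdosRenyi d N) := by unfold erdosRenyi; infer_instance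
  have hPC : SFinite (plantedClique d N κ) := by unfold plantedClique; infer_instance
  rw [hpcRisk, hout, hout, plantedClique_map_adjacency_apply (hmeas false),
    Measure.map_apply measurable_adjacency (hmeas true)]
  simp

/-- A test for planted cliques that runs votes for a finite family of ways to cut tensors out of
the adjacency tensor, one of which succeeds for every planted clique. -/
lemma exists_test_of_family {d N κ : ℕ} {J 𝒯 : Type} [Fintype J] [Fintype 𝒯] [Nonempty 𝒯]
    (P : Program J)
    {p : ℝ} (R : ℕ) (f : 𝒯 → J → {e : Finset (Fin N) // e.card = d})
    (v : 𝒯 → J → Fin d → Fin N)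
    (hv : ∀ τ G j, adjacency G (v τ j) = if G (f τ j) then 1 else 0) (m : 𝒯 → J → ℝ) {σ : ℝ}
    (hσ : 0 < σ) (hm : ∀ τ e, R * ∑ j, (if f τ j = e then m τ j else 0) ^ 2 ≤ σ)
    (h0 : ((gaussianPi fun _ : J => (0 : ℝ)).prod P.randomness).real
      {y | P.output y.1 y.2.1 y.2.2 = true} ≤ p)
    (h1 : ∀ K : Finset (Fin N), K.card = κ → ∃ τ, p + 1 / 2 ≤
      ((gaussianPi fun j => if decide ((f τ j).1 ⊆ K) = true then m τ j
        else 0).prod P.randomness).real {y | P.output y.1 y.2.1 y.2.2 = true}) :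
    ∃ ψ : Program (Fin d → Fin N),
      ψ.time ≤ Fintype.card 𝒯 * (R * (7 * P.time + 6) + 7) ∧
      hpcRisk d N κ ψ ≤ (Fintype.card 𝒯 + 1) *
        voteError R (Fintype.card {e : Finset (Fin N) // e.card = d}) σ := by
  classical
  set A := Finset.powersetCard κ (Finset.univ : Finset (Fin N)) with hA
  -- Each clique is charged to a single `τ` that detects it.
  choose! τ hτ using h1
  set w : ℝ≥0∞ := (N.choose κ : ℝ≥0∞)⁻¹ with hw
  set ε := voteError R (Fintype.card {e : Finset (Fin N) // e.card = d}) σ with hε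
  have hvote := fun t => exists_vote P R (f t) (v t) (hv t) (m t) hσ (hm t) h0
    (A.filter fun K => τ K = t) w (by
      intro K hK
      obtain ⟨hKA, rfl⟩ := Finset.mem_filter.1 hK
      exact hτ K (Finset.mem_powersetCard.1 hKA).2)
  choose F hFe hF0 hF using hvote
  -- The summands are nonnegative, so the sum is positive exactly when some vote rejects. Type-I
  -- errors add up over all votes, while a clique `K` is missed only if the vote for `τ K` misses
  -- it.
  obtain ⟨ψ, hψt, hψ⟩ := (Evaluable.sum Finset.univ fun t _ => hFe t).exists_program
  refine ⟨ψ, by simpa using hψt, ?_⟩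
  rw [hpcRisk_eq hψ, ← hA, ← hw]
  have hpos : ∀ t x, 0 < F t x → 0 < ∑ t, F t x := fun t x h =>
    h.trans_le (Finset.single_le_sum (fun i _ => hF0 i x) (Finset.mem_univ t))
  calc _ ≤ ∑ t, erdosRenyi d N {G | 0 < F t (adjacency G)} +
        ∑ t, ∑ K ∈ A.filter fun K => τ K = t,
          w * erdosRenyi d N {G | ¬ 0 < F t (adjacency (plant K G))} := by
        gcongr
        · refine (measure_mono fun G hG => ?_).trans (measure_iUnion_fintype_le _ _)
          simp only [Set.mem_ofPred_eq, Set.mem_iUnion] at hG ⊢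
          by_contra hne
          push Not at hne
          exact absurd (Finset.sum_nonpos fun t _ => hne t) (not_le.2 hG)
        · rw [← Finset.sum_fiberwise A τ]
          refine Finset.sum_le_sum fun t _ => Finset.sum_le_sum fun K _ => ?_
          gcongr w * ?_
          exact measure_mono fun G h h' => h (hpos t _ h')
    _ = ∑ t, (erdosRenyi d N {G | 0 < F t (adjacency G)} +
          ∑ K ∈ A.filter fun K => τ K = t,
            w * erdosRenyi d N {G | ¬ 0 < F t (adjacency (plant K G))}) :=
        Finset.sum_add_distrib.symm
    _ ≤ ∑ t, (1 + (A.filter fun K => τ K = t).card * w) * ε := Finset.sum_le_sum fun t _ => hF t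
    _ = (Fintype.card 𝒯 + A.card * w) * ε := by
        rw [← Finset.sum_mul, Finset.sum_add_distrib, ← Finset.sum_mul, ← Nat.cast_sum,
          ← Finset.card_eq_sum_card_fiberwise (fun K _ => Finset.mem_univ (τ K))]
        simp
    _ ≤ _ := by
        gcongr
        rw [hA, hw, Finset.card_powersetCard, Finset.card_univ, Fintype.card_fin]
        exact ENNReal.mul_inv_le_one _

/-! ### Cutting tensors out of a hypergraph -/

/-- Discrete intermediate value theorem: a count grows by at most one per step. -/
lemma exists_count_eq (p : ℕ → Prop) [DecidablePred p] (M y : ℕ) (h : y ≤ Nat.count p M) :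
    ∃ x ≤ M, Nat.count p x = y := by
  induction M with
  | zero => exact ⟨0, le_rfl, by simp at h ⊢; omega⟩
  | succ M ih =>
    by_cases hy : y ≤ Nat.count p M
    · obtain ⟨x, hx, h'⟩ := ih hy
      exact ⟨x, by omega, h'⟩
    · refine ⟨M + 1, le_rfl, le_antisymm ?_ h⟩
      rw [Nat.count_succ] at h ⊢
      split_ifs at h ⊢ <;> omega

lemma count_div_mul (K : Finset ℕ) {ℓ : ℕ} (hℓ : 0 < ℓ) (v : ℕ) :
    Nat.count (fun y => y / ℓ ∈ K) (ℓ * v) = ℓ * Nat.count (· ∈ K) v := by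
  induction v with
  | zero => simp
  | succ v ih =>
    rw [Nat.mul_succ, Nat.count_add, ih, Nat.count_succ, mul_add]
    congr 1
    rw [Nat.count_eq_card_filter_range]
    have : ∀ y ∈ Finset.range ℓ, (ℓ * v + y) / ℓ = v := by
      intro y hy
      rw [Nat.mul_add_div hℓ, Nat.div_eq_of_lt (Finset.mem_range.1 hy), add_zero]
    rw [Finset.filter_congr (q := fun _ => v ∈ K) fun y hy => by rw [this y hy]]
    by_cases h : v ∈ K <;> simp [h]

/-- Complete blocks below `y` contribute multiples of `ℓ`, the incomplete one fewer than `ℓ`; so the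
rank of a row yields the rank of its vertex. -/
lemma count_div_div (K : Finset ℕ) {ℓ : ℕ} (hℓ : 0 < ℓ) (y : ℕ) :
    Nat.count (fun y => y / ℓ ∈ K) y / ℓ = Nat.count (· ∈ K) (y / ℓ) := by
  have h : Nat.count (fun y => y / ℓ ∈ K) (ℓ * (y / ℓ) + y % ℓ) / ℓ =
      Nat.count (· ∈ K) (y / ℓ) := by
    rw [Nat.count_add, count_div_mul K hℓ, Nat.mul_add_div hℓ, Nat.add_eq_left]
    exact Nat.div_eq_of_lt ((Nat.count_le _).trans_lt (Nat.mod_lt _ hℓ))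
  rwa [Nat.div_add_mod] at h

/-- Cut points which divide the rows over the vertices in `K` into disjoint groups of `k`. -/
lemma exists_cuts {d N n k ℓ k' : ℕ} (hℓ : 0 < ℓ) (hk : k ≤ ℓ * k') (hn : ℓ * N ≤ n)
    (K : Finset ℕ) (hK : K ⊆ Finset.range N) (hKc : K.card = d * k') :
    ∃ a b : Fin d → Fin (n + 1),
      (∀ i, (Finset.univ.filter fun j : Fin n =>
        (a i : ℕ) ≤ j ∧ (j : ℕ) < b i ∧ (j : ℕ) / ℓ ∈ K).card = k) ∧
      ∀ j : Fin d → Fin n, (∀ i, (a i : ℕ) ≤ j i ∧ (j i : ℕ) < b i ∧ (j i : ℕ) / ℓ ∈ K) →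
        Function.Injective fun i => (j i : ℕ) / ℓ := by
  set p : ℕ → Prop := fun y => y / ℓ ∈ K with hp
  have htot : Nat.count p (ℓ * N) = ℓ * (d * k') := by
    refine (count_div_mul K hℓ N).trans ?_
    rw [Nat.count_eq_card_filter_range,
      Finset.filter_mem_eq_inter, Finset.inter_eq_right.2 hK, hKc]
  have hgrp : ∀ i : Fin d, ℓ * (i * k') + ℓ * k' ≤ ℓ * (d * k') := by
    intro i
    rw [← mul_add, ← Nat.succ_mul]
    exact Nat.mul_le_mul_left _ (Nat.mul_le_mul_right _ i.2)
  -- Group `i` owns the `ℓ * k'` ranks from `ℓ * (i * k')` on, among the rows over `K`; the cuts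
  -- keep the first `k` of them.
  have ha : ∀ i : Fin d, ∃ x ≤ ℓ * N, Nat.count p x = ℓ * (i * k') := fun i =>
    exists_count_eq p _ _ (by rw [htot]; have := hgrp i; omega)
  have hb : ∀ i : Fin d, ∃ x ≤ ℓ * N, Nat.count p x = ℓ * (i * k') + k := fun i =>
    exists_count_eq p _ _ (by rw [htot]; have := hgrp i; omega)
  choose a ha ha' using ha
  choose b hb hb' using hb
  refine ⟨fun i => ⟨a i, by have := ha i; omega⟩, fun i => ⟨b i, by have := hb i; omega⟩,
    fun i => ?_, fun j hj => ?_⟩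
  · have h1 : (Finset.univ.filter fun j : Fin n =>
        a i ≤ j ∧ (j : ℕ) < b i ∧ (j : ℕ) / ℓ ∈ K).card =
        ((Finset.range (b i)).filter p \ (Finset.range (a i)).filter p).card := by
      refine Finset.card_bij (fun j _ => (j : ℕ)) ?_ ?_ ?_
      · intro j hj
        simp only [Finset.mem_filter, Finset.mem_univ, true_and] at hj
        simp only [Finset.mem_sdiff, Finset.mem_filter, Finset.mem_range, hp]
        exact ⟨⟨hj.2.1, hj.2.2⟩, fun h => absurd h.1 (not_lt.2 hj.1)⟩
      · intro j _ j' _ h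
        exact Fin.ext h
      · intro y hy
        simp only [Finset.mem_sdiff, Finset.mem_filter, Finset.mem_range, hp] at hy
        have hbi := hb i
        have hyn : y < n := by omega
        refine ⟨⟨y, hyn⟩, ?_, rfl⟩
        simp only [Finset.mem_filter, Finset.mem_univ, true_and]
        refine ⟨?_, hy.1.1, hy.1.2⟩
        by_contra hlt
        exact hy.2 ⟨by omega, hy.1.2⟩
    have hab : a i ≤ b i ∨ k = 0 := by
      by_contra h
      push Not at h
      have := Nat.count_monotone p h.1.le
      rw [ha', hb'] at this
      omega
    change (Finset.univ.filter fun j : Fin n =>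
        a i ≤ j ∧ (j : ℕ) < b i ∧ (j : ℕ) / ℓ ∈ K).card = k
    have h2 := Nat.count_eq_card_filter_range p (a i)
    have h3 := Nat.count_eq_card_filter_range p (b i)
    rw [ha'] at h2
    rw [hb'] at h3
    rw [h1]
    -- The cuts are known only through their counts, which allow the wrong order only when `k = 0`.
    rcases le_total (a i) (b i) with h | h
    · rw [Finset.card_sdiff_of_subset (Finset.filter_subset_filter _ (Finset.range_mono h)),
        ← h2, ← h3]
      omega
    · have hk0 : k = 0 := by
        have := Nat.count_monotone p h
        rw [ha', hb'] at this
        omega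
      rw [Finset.sdiff_eq_empty_iff_subset.2
        (Finset.filter_subset_filter _ (Finset.range_mono h)), hk0]
      rfl
  -- The vertex alone determines the group, so rows from different groups lie over different
  -- vertices.
  · have hidx : ∀ i, Nat.count (· ∈ K) ((j i : ℕ) / ℓ) / k' = i := by
      intro i
      obtain ⟨h1, h2, h3⟩ := hj i
      simp only at h1 h2
      have h4 : Nat.count p (a i) ≤ Nat.count p (j i) := Nat.count_monotone p h1
      have h5 : Nat.count p (j i) < Nat.count p (b i) := by
        have h6 : Nat.count p (j i + 1) ≤ Nat.count p (b i) := Nat.count_monotone p h2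
        rw [Nat.count_succ, if_pos h3] at h6
        omega
      rw [ha'] at h4
      rw [hb'] at h5
      rw [← count_div_div K hℓ, Nat.div_div_eq_div_mul]
      refine Nat.div_eq_of_lt_le ?_ ?_
      · calc (i : ℕ) * (ℓ * k') = ℓ * (i * k') := by ring
          _ ≤ _ := h4
      · calc _ < ℓ * (i * k') + k := h5
          _ ≤ ℓ * (i * k') + ℓ * k' := by omega
          _ = (i + 1) * (ℓ * k') := by ring
    intro i i' h
    simp only at h
    have := hidx i
    rw [h, hidx i'] at this
    exact Fin.ext this.symm

lemma outputProb_eq_ofReal {d : ℕ} {n : Fin d → ℕ} (P : Program (∀ i, Fin (n i))) (X : Tensor n)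
    (o : Bool) : P.outputProb (observationLaw X) o = ENNReal.ofReal
      (((gaussianPi X).prod P.randomness).real {y | P.output y.1 y.2.1 y.2.2 = o}) := by
  rw [Program.outputProb, observationLaw_eq, ofReal_measureReal (measure_ne_top _ _)]

lemma real_output_false {ι : Type} [Fintype ι] (P : Program ι) (X : ι → ℝ) :
    ((gaussianPi X).prod P.randomness).real {y | P.output y.1 y.2.1 y.2.2 = false} =
      1 - ((gaussianPi X).prod P.randomness).real {y | P.output y.1 y.2.1 y.2.2 = true} := by
  have : {y : (ι → ℝ) × (Fin P.coins → Bool) × (Fin P.normals → ℝ) |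
      P.output y.1 y.2.1 y.2.2 = false} = {y | P.output y.1 y.2.1 y.2.2 = true}ᶜ := by
    ext; simp
  rw [this]
  exact probReal_compl_eq_one_sub (P.measurable_output_prod (measurableSet_singleton true))

lemma add_half_le_of_chcRisk_lt {d : ℕ} {n k : Fin d → ℕ} {lam : ℝ}
    {P : Program (∀ i, Fin (n i))} (h : chcRisk n k lam P < 1 / 2) {X : Tensor n}
    (hX : X ∈ chcSignals n k lam) :
    ((gaussianPi fun _ => (0 : ℝ)).prod P.randomness).real
        {y | P.output y.1 y.2.1 y.2.2 = true} + 1 / 2 ≤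
      ((gaussianPi X).prod P.randomness).real {y | P.output y.1 y.2.1 y.2.2 = true} := by
  have h1 : P.outputProb (observationLaw 0) true + P.outputProb (observationLaw X) false < 1 / 2 :=
    lt_of_le_of_lt (add_le_add le_rfl (le_iSup₂_of_le X hX le_rfl)) h
  rw [outputProb_eq_ofReal, outputProb_eq_ofReal,
    ← ENNReal.ofReal_add measureReal_nonneg measureReal_nonneg,
    show (1 / 2 : ℝ≥0∞) = ENNReal.ofReal (1 / 2) by
      rw [ENNReal.ofReal_div_of_pos two_pos]; simp,
    ENNReal.ofReal_lt_ofReal_iff (by norm_num), real_output_false] at h1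
  change ((gaussianPi (0 : Tensor n)).prod P.randomness).real _ + _ ≤ _
  linarith

lemma adjacency_of_injective {d N : ℕ} (G : Hypergraph d N) {v : Fin d → Fin N}
    (hv : (Finset.univ.image v).card = d) :
    adjacency G v = if G ⟨Finset.univ.image v, hv⟩ then 1 else 0 := by
  simp only [adjacency, hv, dite_true]

lemma card_filter_div_mem_le (n ℓ : ℕ) (hℓ : 0 < ℓ) (S : Finset ℕ) :
    (Finset.univ.filter fun j : Fin n => (j : ℕ) / ℓ ∈ S).card ≤ S.card * ℓ := by
  have h : (Finset.univ.filter fun j : Fin n => (j : ℕ) / ℓ ∈ S).card ≤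
      (S ×ˢ Finset.range ℓ).card := by
    refine Finset.card_le_card_of_injOn (fun j => ((j : ℕ) / ℓ, (j : ℕ) % ℓ)) ?_ ?_
    · intro j hj
      simp only [Finset.coe_filter, Finset.mem_univ, true_and, Set.mem_ofPred_eq] at hj
      simp only [Finset.coe_product, Set.mem_prod, Finset.mem_coe, Finset.mem_range]
      exact ⟨hj, Nat.mod_lt _ hℓ⟩
    · intro j _ j' _ h
      simp only [Prod.mk.injEq] at h
      exact Fin.ext (by rw [← Nat.div_add_mod (j : ℕ) ℓ, h.1, h.2, Nat.div_add_mod])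
  simpa using h

/-- A test for clustering of risk less than `1 / 2` yields a test for planted cliques of small
risk, when every vertex is blown up to at most `ℓ` rows. -/
theorem exists_clique_test {d N n k ℓ k' R : ℕ} {lam σ : ℝ}
    {P : Program (∀ _ : Fin d, Fin n)}
    (hrisk : chcRisk (fun _ : Fin d => n) (fun _ => k) lam P < 1 / 2)
    (hℓ : 0 < ℓ) (hN : d ≤ N) (hk : k ≤ ℓ * k') (hn : ℓ * N ≤ n) (hσ : 0 < σ)
    (hlam : R * ((d * ℓ) ^ d * lam ^ 2) ≤ σ) :
    ∃ ψ : Program (Fin d → Fin N),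
      ψ.time ≤ (n + 1) ^ (2 * d) * (R * (7 * P.time + 6) + 7) ∧
      hpcRisk d N (d * k') ψ ≤ ((n + 1) ^ (2 * d) + 1 : ℕ) * voteError R (N ^ d) σ := by
  classical
  -- a tuple of rows is used if it lies between the cuts and its vertices are distinct
  set act : (Fin d → Fin (n + 1)) × (Fin d → Fin (n + 1)) → (Fin d → Fin n) → Prop := fun τ j =>
    (∀ i, (τ.1 i : ℕ) ≤ j i ∧ (j i : ℕ) < τ.2 i ∧ (j i : ℕ) / ℓ < N) ∧
      Function.Injective fun i => (j i : ℕ) / ℓ with hact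
  -- An unused tuple still needs some hyperedge; the first `d` vertices serve, harmlessly, since its
  -- shift is `0`.
  set v : (Fin d → Fin (n + 1)) × (Fin d → Fin (n + 1)) → (Fin d → Fin n) → Fin d → Fin N := fun τ j =>
    if h : act τ j then fun i => ⟨(j i : ℕ) / ℓ, (h.1 i).2.2⟩ else Fin.castLE hN with hv
  have hvact : ∀ τ j, act τ j → ∀ i, (v τ j i : ℕ) = (j i : ℕ) / ℓ := by
    intro τ j h i
    simp only [hv, dif_pos h]
  have hvinj : ∀ τ j, Function.Injective (v τ j) := by
    intro τ j
    by_cases h : act τ j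
    · intro i i' hii
      refine h.2 ?_
      simp only [← hvact τ j h, hii]
    · simp only [hv, dif_neg h]
      exact Fin.castLE_injective hN
  have hvcard : ∀ τ j, (Finset.univ.image (v τ j)).card = d := fun τ j => by
    rw [Finset.card_image_of_injective _ (hvinj τ j)]; simp
  set f : (Fin d → Fin (n + 1)) × (Fin d → Fin (n + 1)) → (Fin d → Fin n) → {e : Finset (Fin N) // e.card = d} := fun τ j =>
    ⟨Finset.univ.image (v τ j), hvcard τ j⟩ with hf
  set m : (Fin d → Fin (n + 1)) × (Fin d → Fin (n + 1)) → (Fin d → Fin n) → ℝ := fun τ j => if act τ j then lam else 0 with hm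
  -- A used tuple governed by `e` has all its rows over the `d` vertices of `e`, hence at most `(d *
  -- ℓ) ^ d` such tuples.
  have hfib : ∀ τ e, R * ∑ j, (if f τ j = e then m τ j else 0) ^ 2 ≤ σ := by
    intro τ e
    refine le_trans ?_ hlam
    gcongr
    set S := e.1.map Fin.valEmbedding with hS
    set I := Finset.univ.filter fun j : Fin n => (j : ℕ) / ℓ ∈ S with hI
    have hIc : (I.card : ℝ) ≤ d * ℓ := by
      have := card_filter_div_mem_le n ℓ hℓ S
      rw [hS, Finset.card_map, e.2] at this
      exact_mod_cast this
    calc ∑ j, (if f τ j = e then m τ j else 0) ^ 2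
        ≤ ∑ j, if j ∈ Fintype.piFinset (fun _ : Fin d => I) then lam ^ 2 else 0 := by
          refine Finset.sum_le_sum fun j _ => ?_
          by_cases h : f τ j = e ∧ act τ j
          · have hmem : j ∈ Fintype.piFinset (fun _ : Fin d => I) := by
              rw [Fintype.mem_piFinset]
              intro i
              rw [hI, Finset.mem_filter, hS, Finset.mem_map]
              refine ⟨Finset.mem_univ _, v τ j i, ?_, hvact τ j h.2 i⟩
              rw [← h.1]
              exact Finset.mem_image_of_mem _ (Finset.mem_univ i)
            rw [if_pos hmem, if_pos h.1, hm]
            simp only [if_pos h.2]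
            exact le_rfl
          · have h0 : (if f τ j = e then m τ j else 0) = 0 := by
              rw [not_and_or] at h
              rcases h with h | h
              · rw [if_neg h]
              · simp only [hm, if_neg h, ite_self]
            rw [h0, zero_pow two_ne_zero]
            split_ifs <;> positivity
      _ = I.card ^ d * lam ^ 2 := by
          rw [Finset.sum_ite_mem, Finset.univ_inter, Finset.sum_const, Fintype.card_piFinset]
          simp
      _ ≤ _ := by gcongr
  set p : ℝ := ((gaussianPi fun _ : Fin d → Fin n => (0 : ℝ)).prod P.randomness).real
    {y | P.output y.1 y.2.1 y.2.2 = true} with hp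
  have hcut : ∀ K : Finset (Fin N), K.card = d * k' → ∃ τ : (Fin d → Fin (n + 1)) × (Fin d → Fin (n + 1)), p + 1 / 2 ≤
      ((gaussianPi fun j => if decide ((f τ j).1 ⊆ K) = true then m τ j
        else 0).prod P.randomness).real {y | P.output y.1 y.2.1 y.2.2 = true} := by
    intro K hK
    set K' := K.map Fin.valEmbedding with hK'
    have hK'N : ∀ x ∈ K', x < N := by
      intro x hx
      obtain ⟨y, _, rfl⟩ := Finset.mem_map.1 hx
      exact y.2
    obtain ⟨a, b, hab, hinj⟩ := exists_cuts (d := d) hℓ hk hn K'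
      (fun x hx => Finset.mem_range.2 (hK'N x hx)) (by rw [hK', Finset.card_map, hK])
    refine ⟨(a, b), add_half_le_of_chcRisk_lt (k := fun _ => k) hrisk ⟨lam, le_rfl, fun i =>
      Finset.univ.filter fun j : Fin n => (a i : ℕ) ≤ j ∧ (j : ℕ) < b i ∧ (j : ℕ) / ℓ ∈ K', hab,
      ?_⟩⟩
    ext j
    simp only [decide_eq_true_eq, Finset.mem_filter, Finset.mem_univ, true_and]
    -- Since the groups are disjoint, no tuple of the planted block is discarded for a repeated
    -- vertex, and the mean tensor is exactly an admissible signal.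
    by_cases h : ∀ i, (a i : ℕ) ≤ j i ∧ (j i : ℕ) < b i ∧ (j i : ℕ) / ℓ ∈ K'
    · have hA : act (a, b) j := ⟨fun i => ⟨(h i).1, (h i).2.1, hK'N _ (h i).2.2⟩, hinj j h⟩
      have hsub : (f (a, b) j).1 ⊆ K := by
        intro x hx
        obtain ⟨i, _, rfl⟩ := Finset.mem_image.1 hx
        have h3 := (h i).2.2
        rw [← hvact (a, b) j hA i, hK'] at h3
        obtain ⟨y, hy, hyx⟩ := Finset.mem_map.1 h3
        rwa [← Fin.ext (a := y) hyx]
      rw [if_pos hsub, Finset.prod_eq_one fun i _ => if_pos (h i), mul_one]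
      simp only [hm, if_pos hA]
    · have h0 : (if (f (a, b) j).1 ⊆ K then m (a, b) j else 0) = 0 := by
        by_cases hA : act (a, b) j
        · rw [if_neg]
          intro hsub
          refine h fun i => ⟨(hA.1 i).1, (hA.1 i).2.1, ?_⟩
          rw [← hvact (a, b) j hA i]
          exact Finset.mem_map_of_mem Fin.valEmbedding
            (hsub (Finset.mem_image_of_mem _ (Finset.mem_univ i)))
        · simp only [hm, if_neg hA, ite_self]
      obtain ⟨i, hi⟩ := not_forall.1 h
      rw [h0, Finset.prod_eq_zero (Finset.mem_univ i) (if_neg hi), mul_zero]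
  obtain ⟨ψ, hψt, hψ⟩ := exists_test_of_family P R f v
    (fun τ G j => adjacency_of_injective G (hvcard τ j)) m hσ hfib le_rfl hcut
  have hc : Fintype.card ((Fin d → Fin (n + 1)) × (Fin d → Fin (n + 1))) = (n + 1) ^ (2 * d) := by
    rw [Fintype.card_prod, Fintype.card_fun, Fintype.card_fin, Fintype.card_fin, two_mul,
      pow_add]
  refine ⟨ψ, by rwa [hc] at hψt, hψ.trans ?_⟩
  rw [hc]
  push_cast
  gcongr
  rw [voteError, voteError]
  gcongr
  rw [Fintype.card_finset_len, Fintype.card_fin]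
  exact Nat.choose_le_pow N d

/-! ### Weak signals -/

/-- Up to an event of probability `δ` the density ratio is at most two, so power `Q` and type-I
error `a` satisfy `Q ≤ 2 * a + δ`. Together with `Q ≤ 1` this gives `a + 1 - Q ≥ (1 - δ) / 2`. -/
lemma le_chcRisk_of_weak {d n k : ℕ} {lam σ : ℝ} (P : Program (∀ _ : Fin d, Fin n)) (hkn : k ≤ n)
    (hσ : 0 < σ) (hlam : n ^ d * lam ^ 2 ≤ σ) :
    ENNReal.ofReal ((1 - Real.exp (1 / 4 - 1 / (5 * σ))) / 2) ≤
      chcRisk (fun _ : Fin d => n) (fun _ => k) lam P := by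
  obtain ⟨I, -, hI⟩ := Finset.exists_subset_card_eq
    (show k ≤ (Finset.univ : Finset (Fin n)).card by simpa using hkn)
  set X : Tensor (fun _ : Fin d => n) := fun j => lam * ∏ i, (if j i ∈ I then 1 else 0) with hX
  have hmem : X ∈ chcSignals (fun _ : Fin d => n) (fun _ => k) lam :=
    ⟨lam, le_rfl, fun _ => I, fun _ => hI, rfl⟩
  have hnorm : ∑ j, X j ^ 2 ≤ σ := by
    refine le_trans ?_ hlam
    calc ∑ j, X j ^ 2 ≤ ∑ _j : Fin d → Fin n, lam ^ 2 := by
          refine Finset.sum_le_sum fun j _ => ?_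
          have h0 : (0 : ℝ) ≤ ∏ i, (if j i ∈ I then 1 else 0) :=
            Finset.prod_nonneg fun i _ => by split_ifs <;> norm_num
          have h1 : ∏ i, (if j i ∈ I then (1 : ℝ) else 0) ≤ 1 :=
            Finset.prod_le_one (fun i _ => by split_ifs <;> norm_num)
              fun i _ => by split_ifs <;> norm_num
          rw [hX]
          simp only [mul_pow]
          exact mul_le_of_le_one_right (sq_nonneg _) (pow_le_one₀ h0 h1)
      _ = n ^ d * lam ^ 2 := by simp
  set δ := Real.exp (1 / 4 - 1 / (5 * σ)) with hδ
  obtain ⟨B, hB, h1, h2⟩ := exists_restrict_gaussianPi_le X hσ hnorm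
  set γ := gaussianPi (fun _ : Fin d → Fin n => (0 : ℝ)) with hγ
  set S := {y : ((Fin d → Fin n) → ℝ) × (Fin P.coins → Bool) × (Fin P.normals → ℝ) |
    P.output y.1 y.2.1 y.2.2 = true} with hS
  have hSm : MeasurableSet S := P.measurable_output_prod (measurableSet_singleton true)
  have hle : (gaussianPi X).prod P.randomness S ≤
      2 * γ.prod P.randomness S + ENNReal.ofReal δ := by
    rw [Measure.prod_apply hSm, Measure.prod_apply hSm, ← lintegral_add_compl _ hB]
    refine add_le_add ?_ ?_
    · calc _ ≤ ∫⁻ x, P.randomness (Prod.mk x ⁻¹' S) ∂((2 : ℝ≥0∞) • γ) := lintegral_mono' h1 le_rfl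
        _ = _ := by rw [lintegral_smul_measure, smul_eq_mul]
    · calc _ ≤ ∫⁻ _ in Bᶜ, 1 ∂gaussianPi X := lintegral_mono fun _ => prob_le_one
        _ ≤ _ := by rw [setLIntegral_one]; exact h2
  have hle' : ((gaussianPi X).prod P.randomness).real S ≤
      2 * (γ.prod P.randomness).real S + δ := by
    have h := ENNReal.toReal_mono (by finiteness) hle
    rwa [ENNReal.toReal_add (by finiteness) (by finiteness), ENNReal.toReal_mul,
      ENNReal.toReal_ofReal (Real.exp_pos _).le] at h
  have hrisk : P.outputProb (observationLaw 0) true + P.outputProb (observationLaw X) false ≤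
      chcRisk (fun _ : Fin d => n) (fun _ => k) lam P :=
    add_le_add le_rfl (le_iSup₂_of_le X hmem le_rfl)
  refine le_trans ?_ hrisk
  rw [outputProb_eq_ofReal, outputProb_eq_ofReal,
    ← ENNReal.ofReal_add measureReal_nonneg measureReal_nonneg, real_output_false]
  refine ENNReal.ofReal_le_ofReal ?_
  change _ ≤ (γ.prod P.randomness).real S + (1 - ((gaussianPi X).prod P.randomness).real S)
  have h3 : ((gaussianPi X).prod P.randomness).real S ≤ 1 := measureReal_le_one
  linarith

/-! ### The conjecture along a sequence of sizes -/

/-- The reduction need not reach every `N`, and may reach one repeatedly. For each `N` one good pair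
is chosen if there is any, and a trivial one otherwise; infinitely many good sizes already bound the
`liminf`. -/
lemma HPCDetectionConjecture.false_of_frequently {d : ℕ} (h : HPCDetectionConjecture d) {τ : ℝ}
    (hτ : 0 < τ) (hτ1 : τ ≤ 1) (q : Polynomial ℕ)
    (hfreq : ∀ M : ℕ, ∃ N ≥ M, ∃ κ ≤ N, Real.log κ / Real.log (Real.sqrt N) ≤ 1 - τ ∧
      ∃ ψ : Program (Fin d → Fin N), ψ.time ≤ q.eval N ∧ hpcRisk d N κ ψ ≤ 1 / 2) : False := by
  classical
  set good : (N : ℕ) → ℕ × Program (Fin d → Fin N) → Prop := fun N u =>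
    u.1 ≤ N ∧ Real.log u.1 / Real.log (Real.sqrt N) ≤ 1 - τ ∧
      u.2.time ≤ q.eval N ∧ hpcRisk d N u.1 u.2 ≤ 1 / 2 with hgood
  set u : (N : ℕ) → ℕ × Program (Fin d → Fin N) := fun N =>
    if h : ∃ u, good N u then h.choose else (0, ⟨0, 0, []⟩) with hu
  have hu1 : ∀ N, (∃ u, good N u) → good N (u N) := by
    intro N hN
    simp only [hu, dif_pos hN]
    exact hN.choose_spec
  have hu2 : ∀ N, (¬ ∃ u, good N u) → u N = (0, ⟨0, 0, []⟩) := by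
    intro N hN
    simp only [hu, dif_neg hN]
  have hlt := h τ hτ (fun N => (u N).1) (fun N => ?_) ?_ (fun N => (u N).2) ⟨q, fun N => ?_⟩
  · refine absurd hlt (not_lt.2 ?_)
    refine liminf_le_of_frequently_le ?_
    rw [frequently_atTop]
    intro M
    obtain ⟨N, hN, κ, hκ, hlog, ψ, hψ, hr⟩ := hfreq M
    exact ⟨N, hN, (hu1 N ⟨(κ, ψ), hκ, hlog, hψ, hr⟩).2.2.2⟩
  · by_cases hN : ∃ u, good N u
    · exact (hu1 N hN).1
    · rw [hu2 N hN]; exact Nat.zero_le N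
  · refine limsup_le_of_le (h := Filter.Eventually.of_forall fun N => ?_)
    refine EReal.coe_le_coe_iff.2 ?_
    by_cases hN : ∃ u, good N u
    · exact (hu1 N hN).2.1
    -- The default `κ = 0` has `Real.log 0 = 0`, so the ratio is `0`, which needs `τ ≤ 1`.
    · rw [hu2 N hN]; simpa using hτ1
  · by_cases hN : ∃ u, good N u
    · exact (hu1 N hN).2.2.1
    · change (u N).2.time ≤ _
      rw [hu2 N hN]; simp [Program.time]

/-! ### Polynomial orders -/

lemma SoftTheta.eventually_rpow_bounds {a : ℕ → ℝ} {c : ℝ}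
    (h : SoftTheta a fun t => (t : ℝ) ^ c) {η : ℝ} (hη : 0 < η) :
    ∀ᶠ t : ℕ in atTop, 0 < a t ∧ (t : ℝ) ^ (c - η) ≤ a t ∧ a t ≤ (t : ℝ) ^ (c + η) := by
  obtain ⟨ha, -, L, hL, hL'⟩ := h
  have hlog : ∀ᶠ t : ℕ in atTop, 1 < (t : ℝ) := by
    filter_upwards [eventually_gt_atTop 1] with t ht
    exact_mod_cast ht
  have hc : L = c := by
    refine tendsto_nhds_unique hL' (tendsto_const_nhds.congr' ?_)
    filter_upwards [hlog] with t ht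
    rw [Real.log_rpow (by linarith), mul_div_assoc, div_self (Real.log_pos ht).ne', mul_one]
  subst hc
  filter_upwards [ha, hlog, hL.eventually (Ioo_mem_nhds (sub_lt_self L hη) (lt_add_of_pos_right L hη))]
    with t h1 h2 h3
  have h4 := Real.log_pos h2
  have h5 : (0 : ℝ) < t := by linarith
  refine ⟨h1, ?_, ?_⟩
  · rw [Real.rpow_def_of_pos h5, ← Real.le_log_iff_exp_le h1, mul_comm]
    exact ((lt_div_iff₀ h4).1 h3.1).le
  · rw [Real.rpow_def_of_pos h5, ← Real.log_le_iff_le_exp h1, mul_comm]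
    exact ((div_lt_iff₀ h4).1 h3.2).le

lemma polynomial_eval_mono (p : Polynomial ℕ) {a b : ℕ} (h : a ≤ b) : p.eval a ≤ p.eval b := by
  rw [Polynomial.eval_eq_sum, Polynomial.eval_eq_sum]
  exact Finset.sum_le_sum fun i _ => Nat.mul_le_mul_left _ (Nat.pow_le_pow_left h i)

lemma eventually_le_rpow {η : ℝ} (hη : 0 < η) (C : ℝ) : ∀ᶠ t : ℕ in atTop, C ≤ (t : ℝ) ^ η :=
  ((tendsto_rpow_atTop hη).comp tendsto_natCast_atTop_atTop).eventually_ge_atTop C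

lemma tendsto_rpow_mul_exp_neg_rpow (D : ℝ) {η : ℝ} (hη : 0 < η) :
    Tendsto (fun t : ℕ => (t : ℝ) ^ D * Real.exp (-(t : ℝ) ^ η / 8)) atTop (𝓝 0) := by
  have h := (tendsto_rpow_mul_exp_neg_mul_atTop_nhds_zero (D / η) (1 / 8) (by norm_num)).comp
    ((tendsto_rpow_atTop hη).comp tendsto_natCast_atTop_atTop)
  refine h.congr fun t => ?_
  simp only [Function.comp_apply]
  rw [← Real.rpow_mul (Nat.cast_nonneg t), mul_div_cancel₀ _ hη.ne']
  congr 2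
  ring

/-- The lower bound when the signal occupies a nearly constant fraction of the tensor. -/
lemma liminf_chcRisk_of_dense {d : ℕ} {β : ℝ} {n k : ℕ → ℕ} {lam : ℕ → ℝ}
    (hn : SoftTheta (fun t => (n t : ℝ)) (fun t => (t : ℝ) ^ (1 : ℝ)))
    (hkn : ∀ᶠ t in atTop, k t ≤ n t) (hlam : SoftTheta lam (fun t => (t : ℝ) ^ (-β)))
    (hβ : (d : ℝ) / 2 < β) (φ : ∀ t, Program (∀ _ : Fin d, Fin (n t))) :
    1 / 2 ≤ liminf (fun t => chcRisk (fun _ => n t) (fun _ => k t) (lam t) (φ t)) atTop := by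
  -- Solves `d * (1 + η) + 2 * (-β + η) = -η`, the exponent of the bound on `n ^ d * lam ^ 2`.
  set η : ℝ := (2 * β - d) / (d + 3) with hη
  have hη0 : 0 < η := by rw [hη]; apply div_pos <;> [linarith; positivity]
  have hηeq : η * (d + 3) = 2 * β - d := by rw [hη]; field_simp
  have hbound : ∀ᶠ t : ℕ in atTop, ENNReal.ofReal
      ((1 - Real.exp (1 / 4 - 1 / (5 * (t : ℝ) ^ (-η)))) / 2) ≤
      chcRisk (fun _ => n t) (fun _ => k t) (lam t) (φ t) := by
    filter_upwards [hn.eventually_rpow_bounds hη0, hlam.eventually_rpow_bounds hη0, hkn,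
      eventually_gt_atTop 0] with t h1 h2 h3 h4
    have hT : (0 : ℝ) < t := by exact_mod_cast h4
    refine le_chcRisk_of_weak (φ t) h3 (by positivity) ?_
    calc (n t : ℝ) ^ d * lam t ^ 2
        ≤ ((t : ℝ) ^ (1 + η)) ^ d * ((t : ℝ) ^ (-β + η)) ^ 2 := by
          gcongr
          · exact h1.2.2
          · exact h2.1.le
          · exact h2.2.2
      _ = (t : ℝ) ^ (-η) := by
          rw [← Real.rpow_natCast, ← Real.rpow_natCast, ← Real.rpow_mul hT.le,
            ← Real.rpow_mul hT.le, ← Real.rpow_add hT]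
          congr 1
          push_cast
          linarith
  have hlim : Tendsto (fun t : ℕ => ENNReal.ofReal
      ((1 - Real.exp (1 / 4 - 1 / (5 * (t : ℝ) ^ (-η)))) / 2)) atTop (𝓝 (1 / 2)) := by
    have h1 : Tendsto (fun t : ℕ => (t : ℝ) ^ η) atTop atTop :=
      (tendsto_rpow_atTop hη0).comp tendsto_natCast_atTop_atTop
    have h2 : Tendsto (fun t : ℕ => 1 / 4 - (t : ℝ) ^ η / 5) atTop atBot := by
      have := tendsto_neg_atTop_atBot.comp (h1.atTop_div_const (by norm_num : (0 : ℝ) < 5))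
      exact tendsto_atBot_add_const_left atTop (1 / 4) this
    have h3 : Tendsto (fun t : ℕ => ENNReal.ofReal ((1 - Real.exp (1 / 4 - (t : ℝ) ^ η / 5)) / 2))
        atTop (𝓝 (ENNReal.ofReal ((1 - 0) / 2))) :=
      ENNReal.tendsto_ofReal (((Real.tendsto_exp_atBot.comp h2).const_sub 1).div_const 2)
    have e : ENNReal.ofReal ((1 - 0) / 2) = 1 / 2 := by
      rw [ENNReal.ofReal_div_of_pos two_pos]; simp
    rw [e] at h3
    refine h3.congr fun t => ?_
    rw [Real.rpow_neg (Nat.cast_nonneg t)]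
    congr 5
    field_simp
  rw [← hlim.liminf_eq]
  exact liminf_le_liminf hbound

/-! ### Parameters of the reduction -/

lemma voteError_mul_le {d n N R : ℕ} {T η : ℝ} (hT1 : 1 ≤ T) (hnT : (n : ℝ) ≤ T ^ 2)
    (hNn : N ≤ n) (hR1 : T ^ η ≤ R)
    (herr : 6 * 4 ^ d * (T ^ ((6 * d : ℕ) : ℝ) * Real.exp (-T ^ η / 8)) ≤ 1 / 2) :
    ((n + 1) ^ (2 * d) + 1 : ℕ) * voteError R (N ^ d) (T ^ (-η)) ≤ 1 / 2 := by
  have hT0 : 0 < T := by linarith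
  set e := Real.exp (-T ^ η / 8) with he
  have h1 : Real.exp (-((R : ℝ) / 8)) ≤ e := by
    rw [he]; refine Real.exp_le_exp.2 ?_; linarith
  have h2 : Real.exp (1 / 4 - 1 / (5 * T ^ (-η))) ≤ 2 * e := by
    have h3 : 1 / (5 * T ^ (-η)) = T ^ η / 5 := by
      rw [Real.rpow_neg hT0.le]; field_simp
    have h4 : Real.exp (1 / 4) ≤ 2 := by
      have := Real.exp_one_lt_d9
      have h5 : Real.exp (1 / 4) ^ 4 = Real.exp 1 := by rw [← Real.exp_nat_mul]; norm_num
      by_contra h6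
      push Not at h6
      have : (2 : ℝ) ^ 4 ≤ Real.exp (1 / 4) ^ 4 := by gcongr
      linarith
    calc Real.exp (1 / 4 - 1 / (5 * T ^ (-η))) ≤ Real.exp (1 / 4 + -T ^ η / 8) := by
          refine Real.exp_le_exp.2 ?_
          rw [h3]
          have : 0 < T ^ η := by positivity
          linarith
      _ = Real.exp (1 / 4) * e := Real.exp_add _ _
      _ ≤ 2 * e := by gcongr
  have he0 : 0 < e := Real.exp_pos _
  have hT21 : 1 ≤ T ^ 2 := one_le_pow₀ hT1
  have h5 : (((n + 1) ^ (2 * d) + 1 : ℕ) : ℝ) ≤ 2 * (4 ^ d * T ^ (4 * d)) := by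
    have h6 : (n : ℝ) + 1 ≤ 2 * T ^ 2 := by linarith
    have h7 : ((n : ℝ) + 1) ^ (2 * d) ≤ 4 ^ d * T ^ (4 * d) := by
      calc ((n : ℝ) + 1) ^ (2 * d) ≤ (2 * T ^ 2) ^ (2 * d) := by gcongr
        _ = 4 ^ d * T ^ (4 * d) := by
          rw [mul_pow, ← pow_mul, pow_mul 2 2 d, ← mul_assoc]; norm_num
    have h8 : (1 : ℝ) ≤ 4 ^ d * T ^ (4 * d) :=
      one_le_mul_of_one_le_of_one_le (one_le_pow₀ (by norm_num)) (one_le_pow₀ hT1)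
    push_cast
    linarith
  have h6 : (((N ^ d : ℕ) : ℝ)) ≤ T ^ (2 * d) := by
    push_cast
    calc (N : ℝ) ^ d ≤ (T ^ 2) ^ d := by
          gcongr
          exact le_trans (by exact_mod_cast hNn) hnT
      _ = _ := by rw [← pow_mul]
  have h7 : Real.exp (-((R : ℝ) / 8)) +
      ((N ^ d : ℕ) : ℝ) * Real.exp (1 / 4 - 1 / (5 * T ^ (-η))) ≤ 3 * (T ^ (2 * d) * e) := by
    calc _ ≤ e + T ^ (2 * d) * (2 * e) := by gcongr
      _ ≤ T ^ (2 * d) * e + T ^ (2 * d) * (2 * e) := by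
          gcongr
          exact le_mul_of_one_le_left he0.le (one_le_pow₀ hT1)
      _ = _ := by ring
  have h8 : ((((n + 1) ^ (2 * d) + 1 : ℕ) : ℕ) : ℝ≥0∞) * voteError R (N ^ d) (T ^ (-η)) =
      ENNReal.ofReal ((((n + 1) ^ (2 * d) + 1 : ℕ) : ℝ) * (Real.exp (-((R : ℝ) / 8)) +
        ((N ^ d : ℕ) : ℝ) * Real.exp (1 / 4 - 1 / (5 * T ^ (-η))))) := by
    rw [voteError, ENNReal.ofReal_mul (Nat.cast_nonneg _), ENNReal.ofReal_natCast,
      ENNReal.ofReal_add (Real.exp_pos _).le (by positivity),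
      ENNReal.ofReal_mul (Nat.cast_nonneg _), ENNReal.ofReal_natCast]
  rw [h8, show (1 / 2 : ℝ≥0∞) = ENNReal.ofReal (1 / 2) by
    rw [ENNReal.ofReal_div_of_pos two_pos]; simp]
  refine ENNReal.ofReal_le_ofReal (le_trans ?_ herr)
  calc _ ≤ (2 * (4 ^ d * T ^ (4 * d))) * (3 * (T ^ (2 * d) * e)) := by gcongr
    _ = 6 * 4 ^ d * (T ^ ((6 * d : ℕ) : ℝ) * e) := by
        rw [Real.rpow_natCast, show 6 * d = 4 * d + 2 * d by ring, pow_add]; ring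

/-- The choice of parameters for one index: the reduction yields a clique problem of polynomially
related size, whose clique size is of order less than the square root of the number of vertices. -/
lemma exists_clique_test_of_bounds {d : ℕ} (hd : 2 ≤ d) {α β x η : ℝ} (hx0 : 0 < x)
    (hη0 : 0 < η) (h3η : 3 * η ≤ 1 - x) (h4η : 4 * η ≤ (1 - x) / 2 - max (α - x) 0)
    (h5η : 5 * η ≤ 2 * β - d * x) {c : ℕ} (hc : 2 ≤ (1 - x - 2 * η) * c) (p : Polynomial ℕ)
    {n k M t : ℕ} {lam : ℝ} {P : Program (∀ _ : Fin d, Fin n)} (hP : P.time ≤ p.eval n)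
    (hn1 : (t : ℝ) ^ (1 - η) ≤ n) (hn2 : (n : ℝ) ≤ (t : ℝ) ^ (1 + η))
    (hk : (k : ℝ) ≤ (t : ℝ) ^ (α + η)) (hlam0 : 0 < lam) (hlam : lam ≤ (t : ℝ) ^ (-β + η))
    (ht : 1 ≤ t) (hM : (M : ℝ) ≤ (t : ℝ) ^ η) (hT : 2 * (2 * d : ℝ) ^ d ≤ (t : ℝ) ^ η)
    (hT' : 2 * d ≤ (t : ℝ) ^ η)
    (herr : 6 * 4 ^ d * ((t : ℝ) ^ ((6 * d : ℕ) : ℝ) * Real.exp (-(t : ℝ) ^ η / 8)) ≤ 1 / 2)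
    (hrisk : chcRisk (fun _ : Fin d => n) (fun _ => k) lam P < 1 / 2) :
    ∃ N ≥ M, ∃ κ ≤ N, Real.log κ / Real.log (Real.sqrt N) ≤ 1 - η ∧
      ∃ ψ : Program (Fin d → Fin N), ψ.time ≤
        (N ^ c + 1) ^ (2 * d) * (N ^ c * (7 * p.eval (N ^ c) + 6) + 7) ∧
        hpcRisk d N κ ψ ≤ 1 / 2 := by
  set T : ℝ := (t : ℝ) with hTdef
  have hT1 : 1 ≤ T := by rw [hTdef]; exact_mod_cast ht
  have hT0 : 0 < T := by linarith
  have hd' : (2 : ℝ) ≤ d := by exact_mod_cast hd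
  have hmono : ∀ {a b : ℝ}, a ≤ b → T ^ a ≤ T ^ b := fun h =>
    Real.rpow_le_rpow_of_exponent_le hT1 h
  have hone : ∀ {a : ℝ}, 0 ≤ a → 1 ≤ T ^ a := fun h => Real.one_le_rpow hT1 h
  set ℓ : ℕ := ⌈T ^ x⌉₊ with hℓ
  have hℓ1 : T ^ x ≤ ℓ := Nat.le_ceil _
  have hℓ2 : (ℓ : ℝ) ≤ 2 * T ^ x := by
    have := (Nat.ceil_lt_add_one (Real.rpow_nonneg hT0.le x)).le
    have := hone hx0.le
    linarith
  have hℓ0 : 0 < ℓ := by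
    have : (0 : ℝ) < ℓ := lt_of_lt_of_le (by positivity) hℓ1
    exact_mod_cast this
  set R : ℕ := ⌈T ^ η⌉₊ with hR
  have hR1 : T ^ η ≤ R := Nat.le_ceil _
  have hR2 : (R : ℝ) ≤ 2 * T ^ η := by
    have := (Nat.ceil_lt_add_one (Real.rpow_nonneg hT0.le η)).le
    have := hone hη0.le
    linarith
  set N : ℕ := n / ℓ with hN
  -- the number of vertices
  have hNlow : T ^ (1 - x - 2 * η) ≤ N := by
    have h1 : (n : ℝ) ≤ ℓ * (N + 1) := by
      have := (Nat.lt_mul_div_succ n hℓ0).le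
      exact_mod_cast this
    have h2 : T ^ (1 - η) ≤ 2 * T ^ x * (N + 1) := by
      refine hn1.trans (h1.trans ?_)
      gcongr
    have h3 : T ^ (1 - η) = T ^ x * (T ^ (1 - x - 2 * η) * T ^ η) := by
      rw [← Real.rpow_add hT0, ← Real.rpow_add hT0]; congr 1; ring
    have h4 : T ^ (1 - x - 2 * η) * T ^ η ≤ 2 * (N + 1) := by
      have hpos : 0 < T ^ x := by positivity
      refine le_of_mul_le_mul_left ?_ hpos
      rw [← h3]
      linarith
    have h5 : 1 ≤ T ^ (1 - x - 2 * η) := hone (by linarith)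
    -- `T ^ η ≥ 2 * d ≥ 4` absorbs the factor `2` and, with `h5`, the rounding.
    nlinarith
  have hNη : T ^ η ≤ N := (hmono (by linarith)).trans hNlow
  have hdN : d ≤ N := by
    have : (d : ℝ) ≤ N := by linarith
    exact_mod_cast this
  have hMN : M ≤ N := by
    have : (M : ℝ) ≤ N := hM.trans hNη
    exact_mod_cast this
  have hN1 : (1 : ℝ) < N := by
    have : (d : ℝ) ≤ N := by exact_mod_cast hdN
    linarith
  have hNn : N ≤ n := Nat.div_le_self n ℓ
  -- the size of the clique
  set k' : ℕ := k / ℓ + 1 with hk'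
  have hkk : k ≤ ℓ * k' := (Nat.lt_mul_div_succ k hℓ0).le
  set A : ℝ := max (α - x) 0 with hA
  have hκ : ((d * k' : ℕ) : ℝ) ≤ (N : ℝ) ^ ((1 - η) / 2) := by
    have h1 : ((k / ℓ : ℕ) : ℝ) ≤ T ^ (A + η) := by
      calc ((k / ℓ : ℕ) : ℝ) ≤ k / ℓ := Nat.cast_div_le
        _ ≤ T ^ (α + η) / T ^ x := by gcongr
        _ = T ^ (α - x + η) := by rw [← Real.rpow_sub hT0]; congr 1; ring
        _ ≤ T ^ (A + η) := hmono (by have := le_max_left (α - x) 0; linarith)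
    have hA0 : 0 ≤ A := le_max_right _ _
    have h2 : 1 ≤ T ^ (A + η) := hone (by linarith)
    calc ((d * k' : ℕ) : ℝ) = d * (((k / ℓ : ℕ) : ℝ) + 1) := by rw [hk']; push_cast; ring
      _ ≤ d * (T ^ (A + η) + T ^ (A + η)) := by gcongr
      _ = 2 * d * T ^ (A + η) := by ring
      _ ≤ T ^ η * T ^ (A + η) := by gcongr
      _ = T ^ (A + 2 * η) := by rw [← Real.rpow_add hT0]; congr 1; ring
      -- The product loses at most `3 * η / 2` from `(1 - x) / 2`, so `h4η` leaves room for `A + 2 *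
      -- η`.
      _ ≤ T ^ ((1 - x - 2 * η) * ((1 - η) / 2)) := hmono (by nlinarith)
      _ = (T ^ (1 - x - 2 * η)) ^ ((1 - η) / 2) := Real.rpow_mul hT0.le _ _
      _ ≤ (N : ℝ) ^ ((1 - η) / 2) := Real.rpow_le_rpow (by positivity) hNlow (by linarith)
  have hκN : d * k' ≤ N := by
    have : ((d * k' : ℕ) : ℝ) ≤ N := by
      refine hκ.trans ?_
      calc (N : ℝ) ^ ((1 - η) / 2) ≤ (N : ℝ) ^ (1 : ℝ) :=
            Real.rpow_le_rpow_of_exponent_le hN1.le (by linarith)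
        _ = N := Real.rpow_one _
    exact_mod_cast this
  have hκ0 : (0 : ℝ) < ((d * k' : ℕ) : ℝ) := by
    have : 0 < d * k' := Nat.mul_pos (by omega) (Nat.succ_pos _)
    exact_mod_cast this
  have hlog : Real.log ((d * k' : ℕ) : ℝ) / Real.log (Real.sqrt N) ≤ 1 - η := by
    have hlN : 0 < Real.log N := Real.log_pos hN1
    rw [Real.log_sqrt (by linarith), div_le_iff₀ (by linarith)]
    calc _ ≤ Real.log ((N : ℝ) ^ ((1 - η) / 2)) := Real.log_le_log hκ0 hκ
      _ = (1 - η) * (Real.log N / 2) := by rw [Real.log_rpow (by linarith)]; ring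
  -- the strength of the signal
  have hσ : R * (((d : ℝ) * ℓ) ^ d * lam ^ 2) ≤ T ^ (-η) := by
    calc R * (((d : ℝ) * ℓ) ^ d * lam ^ 2)
        ≤ (2 * T ^ η) * ((d * (2 * T ^ x)) ^ d * (T ^ (-β + η)) ^ 2) := by gcongr
      _ = 2 * (2 * d : ℝ) ^ d * (T ^ η * ((T ^ x) ^ d * (T ^ (-β + η)) ^ 2)) := by
          rw [show (d : ℝ) * (2 * T ^ x) = (2 * d) * T ^ x by ring, mul_pow]; ring
      _ = 2 * (2 * d : ℝ) ^ d * T ^ (d * x - 2 * β + 3 * η) := by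
          have e1 : (T ^ x) ^ d = T ^ (x * d) := by rw [Real.rpow_mul hT0.le, Real.rpow_natCast]
          have e2 : (T ^ (-β + η)) ^ 2 = T ^ ((-β + η) * 2) := by
            rw [Real.rpow_mul hT0.le, Real.rpow_ofNat]
          rw [e1, e2, ← Real.rpow_add hT0, ← Real.rpow_add hT0]
          congr 2
          ring
      -- The constant goes into `T ^ η`, and `h5η` bounds the exponent by `-2 * η`.
      _ ≤ T ^ η * T ^ (-(2 * η)) := by
          gcongr
          linarith
      _ = T ^ (-η) := by rw [← Real.rpow_add hT0]; congr 1; ring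
  obtain ⟨ψ, hψt, hψ⟩ := exists_clique_test hrisk hℓ0 hdN hkk (Nat.mul_div_le n ℓ)
    (by positivity : 0 < T ^ (-η)) hσ
  -- polynomial bounds
  have hN2 : T ^ (2 : ℝ) ≤ ((N ^ c : ℕ) : ℝ) := by
    calc T ^ (2 : ℝ) ≤ T ^ ((1 - x - 2 * η) * c) := hmono hc
      _ = (T ^ (1 - x - 2 * η)) ^ c := by rw [Real.rpow_mul hT0.le, Real.rpow_natCast]
      _ ≤ (N : ℝ) ^ c := by gcongr
      _ = _ := by push_cast; rfl
  have hnT : (n : ℝ) ≤ T ^ (2 : ℝ) := hn2.trans (hmono (by linarith))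
  have hnc : n ≤ N ^ c := by
    have := hnT.trans hN2
    exact_mod_cast this
  have hRc : R ≤ N ^ c := by
    have : (R : ℝ) ≤ ((N ^ c : ℕ) : ℝ) := by
      calc (R : ℝ) ≤ 2 * T ^ η := hR2
        _ ≤ T ^ η * T ^ η := by gcongr; linarith
        _ = T ^ (η + η) := (Real.rpow_add hT0 _ _).symm
        _ ≤ T ^ (2 : ℝ) := hmono (by linarith)
        _ ≤ _ := hN2
    exact_mod_cast this
  refine ⟨N, hMN, d * k', hκN, hlog, ψ, hψt.trans ?_, hψ.trans ?_⟩
  · have := polynomial_eval_mono p hnc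
    gcongr
    exact hP.trans this
  · rw [Real.rpow_ofNat] at hnT
    exact voteError_mul_le hT1 hnT hNn hR1 herr

end HighOrderClustering

/-! ### Choice of the blow-up exponent and conclusion -/

theorem mainTheorem4 (d : ℕ) (hd : 2 ≤ d) (hHPC : HPCDetectionConjecture d)
    (α β : ℝ) (hα0 : 0 ≤ α) (hα1 : α ≤ 1)
    (n k : ℕ → ℕ) (lam : ℕ → ℝ)
    (hn : SoftTheta (fun t => (n t : ℝ)) (fun t => (t : ℝ)))
    (hk : SoftTheta (fun t => (k t : ℝ)) (fun t => (t : ℝ) ^ α))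
    (hkn : ∀ᶠ t in atTop, k t ≤ n t)
    (hlam : SoftTheta lam (fun t => (t : ℝ) ^ (-β)))
    (hβ : max (d * α - d / 2) 0 < β)
    (φ : ∀ t, Program (∀ _ : Fin d, Fin (n t))) (hφ : IsPolyTime n φ) :
    1 / 2 ≤ liminf (fun t => chcRisk (fun _ => n t) (fun _ => k t) (lam t) (φ t)) atTop := by
  have hn' : SoftTheta (fun t => (n t : ℝ)) (fun t => (t : ℝ) ^ (1 : ℝ)) := by simpa using hn
  have hd0 : (0 : ℝ) < d := by exact_mod_cast (by omega : 0 < d)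
  have hβ1 : d * α - d / 2 < β := (le_max_left _ _).trans_lt hβ
  have hβ2 : 0 < β := (le_max_right _ _).trans_lt hβ
  rcases hα1.eq_or_lt with rfl | hα
  · exact liminf_chcRisk_of_dense hn' hkn hlam (by linarith) φ
  by_contra hlt
  have hbad := frequently_lt_of_liminf_lt (by isBoundedDefault) (not_le.1 hlt)
  -- The lower bound on `x` puts the clique below the square root of the number of vertices; `x < 1`
  -- keeps the number of vertices polynomial in `t`, and `x < 2 * β / d` makes the shift per bit
  -- vanish.
  obtain ⟨x, hx1, hx2⟩ : ∃ x, max (2 * α - 1) 0 < x ∧ x < min 1 (2 * β / d) := by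
    refine exists_between (max_lt (lt_min (by linarith) ?_) (lt_min one_pos (by positivity)))
    rw [lt_div_iff₀ hd0]
    linarith
  have hxα : 2 * α - 1 < x := (le_max_left _ _).trans_lt hx1
  have hx0 : 0 < x := (le_max_right _ _).trans_lt hx1
  have hx1' : x < 1 := hx2.trans_le (min_le_left _ _)
  have hxβ : d * x < 2 * β := by
    have := (lt_div_iff₀ hd0).1 (hx2.trans_le (min_le_right _ _))
    linarith
  have hgap : 0 < (1 - x) / 2 - max (α - x) 0 := by
    rw [sub_pos]
    exact max_lt (by linarith) (by linarith)
  set η : ℝ := min (min 1 ((1 - x) / 3))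
    (min (((1 - x) / 2 - max (α - x) 0) / 4) ((2 * β - d * x) / 5)) with hη
  have hη0 : 0 < η := by
    refine lt_min (lt_min one_pos (by linarith)) (lt_min (by linarith) (by linarith))
  have hη1 : η ≤ 1 := (min_le_left _ _).trans (min_le_left _ _)
  have h3η : η ≤ (1 - x) / 3 := (min_le_left _ _).trans (min_le_right _ _)
  have h4η : η ≤ ((1 - x) / 2 - max (α - x) 0) / 4 := (min_le_right _ _).trans (min_le_left _ _)
  have h5η : η ≤ (2 * β - d * x) / 5 := (min_le_right _ _).trans (min_le_right _ _)
  -- With this `c`, `t ^ 2 ≤ N ^ c`, so running times polynomial in `n` are polynomial in `N`.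
  obtain ⟨c, hc⟩ := exists_nat_ge (2 / (1 - x - 2 * η))
  have hc' : 2 ≤ (1 - x - 2 * η) * c := by
    rw [div_le_iff₀ (by linarith)] at hc
    linarith
  obtain ⟨p, hp⟩ := hφ
  refine hHPC.false_of_frequently hη0 hη1 ((Polynomial.X ^ c + 1) ^ (2 * d) *
    (Polynomial.X ^ c * (7 * p.comp (Polynomial.X ^ c) + 6) + 7)) fun M => ?_
  have herr : ∀ᶠ t : ℕ in atTop,
      6 * 4 ^ d * ((t : ℝ) ^ ((6 * d : ℕ) : ℝ) * Real.exp (-(t : ℝ) ^ η / 8)) ≤ 1 / 2 := by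
    have h := (tendsto_rpow_mul_exp_neg_rpow ((6 * d : ℕ) : ℝ) hη0).const_mul (6 * 4 ^ d)
    rw [mul_zero] at h
    exact h.eventually_le_const (by norm_num)
  obtain ⟨t, hrisk, h1, h2, h3, h4, h5, h6, h7, h8⟩ := (hbad.and_eventually
    ((hn'.eventually_rpow_bounds hη0).and ((hk.eventually_rpow_bounds hη0).and
      ((hlam.eventually_rpow_bounds hη0).and ((eventually_ge_atTop 1).and
        ((eventually_le_rpow hη0 M).and ((eventually_le_rpow hη0 (2 * (2 * d : ℝ) ^ d)).and
          ((eventually_le_rpow hη0 (2 * d)).and herr)))))))).exists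
  have := exists_clique_test_of_bounds hd hx0 hη0 (by linarith) (by linarith) (by linarith)
    hc' p (hp t) h1.2.1 h1.2.2 h2.2.2 h3.1 h3.2.2 h4 h5 h6 h7 h8 hrisk
  simpa using this
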